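/- Work in a fixed countably saturated nonstandard universe (transfer holds, and every sequence of internal sets with the finite intersection property has nonempty intersection), with ${}^*\mathbb N$ the set of hyperintegers and $\mathbb N\subseteq{}^*\mathbb N$. A set is *Borel* if it belongs to the least $\sigma$-algebra (of subsets of ${}^*\mathbb N$, or of ${}^*\mathbb N\times{}^*\mathbb N$) containing all internal sets. A set $X$ is *countably determined* (CD) if $$X=\bigcup_{b\in B}\Bigl(\bigcap_{m\in b}X_m\cap\bigcap_{m\notin b}\Bigl(\bigcup_n X_n\setminus X_m\Bigr)\Bigr)$$ for some sequence of internal sets $X_m$ $(m\in\mathbb N)$ and some $B\subseteq\mathcal P(\mathbb N)$. For $X,Y\subseteq{}^*\mathbb N$ write $X\le_{CD}Y$ if there is an injection $X\to Y$ whose graph is a CD subset of ${}^*\mathbb N\times{}^*\mathbb N$; write $X\equiv_{CD}Y$ if $X\le_{CD}Y$ and $Y\le_{CD}X$, and $X<_{CD}Y$ if $X\le_{CD}Y$ but not $Y\le_{CD}X$. A *cut* is an initial segment $U\subseteq{}^*\mathbb N$; it is *additive* if $x+y\in U$ for all $x,y\in U$. For $c\in{}^*\mathbb N$ put $$c/\mathbb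 N=\{x\in{}^*\mathbb N: nx\le c\text{ for all }n\in\mathbb N,\ n\ge 1\},\qquad c\,\mathbb N=\{x\in{}^*\mathbb N: x\le cn\text{ for some }n\in\mathbb N\}.$$ Call $c\in{}^*\mathbb N$ *infinitely large* if $c\notin\mathbb N$. **Theorem.** Let $X\subseteq{}^*\mathbb N$ be an infinite CD set. Then either there is a unique additive Borel cut $U$ with $U\equiv_{CD}X$, or there is an infinitely large $c\in{}^*\mathbb N$ such that $c/\mathbb N<_{CD}X<_{CD}c\,\mathbb N$. -/

import Mathlib

open Set

/-- The types of the finite type hierarchy over `ℕ` (the typed form of the superstructure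
over `ℕ`): `ℕ` itself, products, and power sets. -/
class inductive StandardType : Type → Prop
  | nat : StandardType ℕ
  | prod {α β : Type} : StandardType α → StandardType β → StandardType (α × β)
  | set {α : Type} : StandardType α → StandardType (Set α)

instance StandardType.instNat : StandardType ℕ := StandardType.nat

instance StandardType.instProd {α β : Type} [hα : StandardType α] [hβ : StandardType β] :
    StandardType (α × β) := StandardType.prod hα hβ

instance StandardType.instSet {α : Type} [hα : StandardType α] : StandardType (Set α) :=
  StandardType.set hα

universe u

/-- A nonstandard universe over the finite type hierarchy on `ℕ`. Every standard type `α` has a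
nonstandard extension `Hyper α` (the internal objects of type `α`), every function `f` an
extension `map f`, and every set `A` (in particular, every relation) an extension `starSet A`.

The last group of laws is the transfer principle: the passage `A ↦ starSet A` commutes with
negation, conjunction, substitution (inverse images under arbitrary functions) and existential
quantification (images, in particular projections), hence with every first-order construction
over these types, the membership relations `a ∈ A` between `α` and `Set α` included. (Equality is
transferred as well, the diagonal being the image of `x ↦ (x, x)`.) -/
structure NonstandardUniverse where
  Hyper : (α : Type) → [StandardType α] → Type u
  std : {α : Type} → [StandardType α] → α → Hyper α
  map : {α β : Type} → [StandardType α] → [StandardType β] → (α → β) → Hyper α → Hyper β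
  starSet : {α : Type} → [StandardType α] → Set α → Set (Hyper α)
  map_id : ∀ {α : Type} [StandardType α] (x : Hyper α), map (id : α → α) x = x
  map_comp : ∀ {α β γ : Type} [StandardType α] [StandardType β] [StandardType γ]
    (g : β → γ) (f : α → β) (x : Hyper α), map (g ∘ f) x = map g (map f x)
  /-- An internal pair is the same thing as a pair of internal objects. -/
  prod_bijective : ∀ {α β : Type} [StandardType α] [StandardType β],
    Function.Bijective
      (fun p : Hyper (α × β) =>
        ((map (Prod.fst : α × β → α) p, map (Prod.snd : α × β → β) p) : Hyper α × Hyper β))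
  starSet_singleton : ∀ {α : Type} [StandardType α] (a : α), starSet {a} = {std a}
  starSet_compl : ∀ {α : Type} [StandardType α] (A : Set α), starSet Aᶜ = (starSet A)ᶜ
  starSet_inter : ∀ {α : Type} [StandardType α] (A B : Set α),
    starSet (A ∩ B) = starSet A ∩ starSet B
  starSet_preimage : ∀ {α β : Type} [StandardType α] [StandardType β] (f : α → β) (B : Set β),
    starSet (f ⁻¹' B) = map f ⁻¹' starSet B
  starSet_image : ∀ {α β : Type} [StandardType α] [StandardType β] (f : α → β) (A : Set α),
    starSet (f '' A) = map f '' starSet A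

namespace NonstandardUniverse

variable (U : NonstandardUniverse.{u})

section General

variable {α β : Type} [StandardType α] [StandardType β]

/-- The internal pair with given components. -/
noncomputable def pair (x : U.Hyper α) (y : U.Hyper β) : U.Hyper (α × β) :=
  (Equiv.ofBijective _ (U.prod_bijective (α := α) (β := β))).symm (x, y)

/-- The set of elements of an internal object of type `Set α`, given by the nonstandard extension
of the membership relation. -/
def ext (A : U.Hyper (Set α)) : Set (U.Hyper α) :=
  {x | U.pair x A ∈ U.starSet {p : α × Set α | p.1 ∈ p.2}}

/-- Internal subsets of `Hyper α`. -/
def IsInternal (X : Set (U.Hyper α)) : Prop :=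
  ∃ A : U.Hyper (Set α), X = U.ext A

/-- Borel sets: the least `σ`-algebra containing the internal sets. -/
def IsBorel (X : Set (U.Hyper α)) : Prop :=
  @MeasurableSet (U.Hyper α)
    (MeasurableSpace.generateFrom {Y : Set (U.Hyper α) | U.IsInternal Y}) X

/-- Countably determined sets. -/
def IsCD (X : Set (U.Hyper α)) : Prop :=
  ∃ (A : ℕ → Set (U.Hyper α)) (B : Set (Set ℕ)), (∀ m, U.IsInternal (A m)) ∧
    X = ⋃ b ∈ B, ((⋂ m ∈ b, A m) ∩ ⋂ m ∈ bᶜ, ((⋃ n, A n) \ A m))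

end General

/-- Countable saturation: a sequence of internal sets with the finite intersection property has
nonempty intersection. -/
def CountablySaturated : Prop :=
  ∀ (α : Type) [StandardType α] (A : ℕ → Set (U.Hyper α)),
    (∀ n, U.IsInternal (A n)) → (∀ s : Finset ℕ, (⋂ n ∈ s, A n).Nonempty) →
      (⋂ n, A n).Nonempty

/-! Order and arithmetic of the hyperintegers `U.Hyper ℕ`. -/

instance : LE (U.Hyper ℕ) :=
  ⟨fun x y => U.pair x y ∈ U.starSet {p : ℕ × ℕ | p.1 ≤ p.2}⟩

noncomputable instance : Add (U.Hyper ℕ) :=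
  ⟨fun x y => U.map (fun p : ℕ × ℕ => p.1 + p.2) (U.pair x y)⟩

noncomputable instance : Mul (U.Hyper ℕ) :=
  ⟨fun x y => U.map (fun p : ℕ × ℕ => p.1 * p.2) (U.pair x y)⟩

/-- Infinitely large hyperintegers: those not in `ℕ`. -/
def IsInfinitelyLarge (c : U.Hyper ℕ) : Prop :=
  ∀ n : ℕ, c ≠ U.std n

/-- Cuts: initial segments of the hyperintegers. -/
def IsCut (C : Set (U.Hyper ℕ)) : Prop :=
  ∀ x ∈ C, ∀ y : U.Hyper ℕ, y ≤ x → y ∈ C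

/-- Additive cuts. -/
def IsAdditiveCut (C : Set (U.Hyper ℕ)) : Prop :=
  U.IsCut C ∧ ∀ x ∈ C, ∀ y ∈ C, x + y ∈ C

/-- The cut `c/ℕ`, the intersection of the segments `[0, c/n]` over positive `n ∈ ℕ`. -/
def divNat (c : U.Hyper ℕ) : Set (U.Hyper ℕ) :=
  {x | ∀ n : ℕ, 0 < n → U.std n * x ≤ c}

/-- The cut `cℕ`, the union of the segments `[0, cn]` over `n ∈ ℕ`. -/
def mulNat (c : U.Hyper ℕ) : Set (U.Hyper ℕ) :=
  {x | ∃ n : ℕ, x ≤ c * U.std n}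

/-- The graph of the restriction of `f` to `X`, as a set of internal pairs. -/
def graphOn (X : Set (U.Hyper ℕ)) (f : U.Hyper ℕ → U.Hyper ℕ) : Set (U.Hyper (ℕ × ℕ)) :=
  {p | ∃ x ∈ X, p = U.pair x (f x)}

/-- `X ≤_CD Y`: there is an injection of `X` into `Y` whose graph is countably determined. -/
def CDLe (X Y : Set (U.Hyper ℕ)) : Prop :=
  ∃ f : U.Hyper ℕ → U.Hyper ℕ, MapsTo f X Y ∧ InjOn f X ∧ U.IsCD (U.graphOn X f)

/-- `X ≡_CD Y`. -/
def CDEquiv (X Y : Set (U.Hyper ℕ)) : Prop :=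
  U.CDLe X Y ∧ U.CDLe Y X

/-- `X <_CD Y`. -/
def CDLt (X Y : Set (U.Hyper ℕ)) : Prop :=
  U.CDLe X Y ∧ ¬ U.CDLe Y X

end NonstandardUniverse

/-! `X` is measured from inside by the cut I = `innerCut X` of hyperintegers below the internal
cardinality of some internal subset of `X`. By `exists_souslin`, `X` is a union of intersections of
decreasing sequences drawn from one countable family of internal sets. If c is outside I, saturation
(`mem_innerCut`) forces a set of cardinality at most c into each sequence, so countably many such
sets cover `X`; laying them end to end gives X ≤ cℕ. If c is in I, the segment [0, c] embeds in `X`.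
Whenever c/ℕ ≤ X ≤ cℕ with c infinitely large, either both comparisons are strict or `X` is
equivalent to one of these two additive Borel cuts (`dichotomy_of_between`). This settles the case
where I is not additive.

Let I be additive. Suppose first that every set of some sequence has cardinality exceeding all
elements of I. Then I is the intersection of the segments given by these cardinalities, and one
internal enumeration of the chain embeds I in `X`. Either c/ℕ ⊆ I for some c outside I, which gives
the sandwich, or below each d outside I there is an infinitely smaller one outside I. In the latter
case `X` lies in a decreasing sequence of internal sets whose size bounds descend to I, and X ≤ I.
Suppose instead that every sequence contains a set of size bounded in I. Then `X` is covered by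
countably many internal sets with bounds γ_i in I. If these bounds and ℕ have a common bound in I,
the sandwich applies; if not, they are cofinal in I, and consecutive segments embed `X` in I while
an increasing chain of internal subsets of `X` receives I.

Uniqueness rests on `not_cdLe_divNat`: a counting argument shows that [0, d) does not embed in d/ℕ
for infinitely large d, whereas an additive cut omitting d is contained in d/ℕ. -/

namespace NonstandardUniverse

open Filter

variable (U : NonstandardUniverse.{u})

/-! ### Transfer: internal objects as functions of a common parameter. -/

section Transfer

variable {α β γ δ : Type} [StandardType α] [StandardType β] [StandardType γ] [StandardType δ]

lemma starSet_empty : U.starSet (∅ : Set α) = ∅ := by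
  have h := U.starSet_inter (∅ : Set α) ∅ᶜ
  rw [U.starSet_compl, inter_compl_self, inter_compl_self] at h
  exact h

lemma starSet_univ : U.starSet (univ : Set α) = univ := by
  rw [← compl_empty, U.starSet_compl, U.starSet_empty, compl_empty]

lemma starSet_mono {A B : Set α} (h : A ⊆ B) : U.starSet A ⊆ U.starSet B := by
  rw [← inter_eq_left.2 h, U.starSet_inter]
  exact inter_subset_right

/-- The ultrafilter of standard sets whose extension contains a given internal object. -/
def ult (p : U.Hyper γ) : Ultrafilter γ :=
  Ultrafilter.ofComplNotMemIff
    { sets := {A | p ∈ U.starSet A}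
      univ_sets := by simp [U.starSet_univ]
      sets_of_superset := fun hA h => U.starSet_mono h hA
      inter_sets := fun hA hB => by
        simp only [mem_ofPred_eq, U.starSet_inter]
        exact ⟨hA, hB⟩ }
    (fun s => by
      change ¬ (p ∈ U.starSet sᶜ) ↔ p ∈ U.starSet s
      simp [U.starSet_compl])

end Transfer

variable {U}

section Transfer

variable {α β γ δ : Type} [StandardType α] [StandardType β] [StandardType γ] [StandardType δ]

/-- The working form of transfer, in the manner of Łoś: once all objects involved are images of one
`p`, relations between them are checked pointwise, for almost all `t`. -/
lemma map_mem_starSet {p : U.Hyper γ} {f : γ → α} {B : Set α} :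
    U.map f p ∈ U.starSet B ↔ ∀ᶠ t in U.ult p, f t ∈ B := by
  change p ∈ U.map f ⁻¹' U.starSet B ↔ _
  rw [← U.starSet_preimage]
  rfl

lemma map_map {g : α → β} {f : γ → α} {p : U.Hyper γ} :
    U.map g (U.map f p) = U.map (fun t => g (f t)) p :=
  (U.map_comp g f p).symm

lemma eventually_ult_map {f : γ → α} {p : U.Hyper γ} {φ : α → Prop} :
    (∀ᶠ t in U.ult (U.map f p), φ t) ↔ ∀ᶠ t in U.ult p, φ (f t) :=
  map_mem_starSet (B := {t | φ t})

@[simp] lemma map_fst_pair (x : U.Hyper α) (y : U.Hyper β) :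
    U.map Prod.fst (U.pair x y) = x :=
  congrArg Prod.fst ((Equiv.ofBijective _ (U.prod_bijective (α := α) (β := β))).apply_symm_apply
    (x, y))

@[simp] lemma map_snd_pair (x : U.Hyper α) (y : U.Hyper β) :
    U.map Prod.snd (U.pair x y) = y :=
  congrArg Prod.snd ((Equiv.ofBijective _ (U.prod_bijective (α := α) (β := β))).apply_symm_apply
    (x, y))

lemma prod_ext {p q : U.Hyper (α × β)} (h₁ : U.map Prod.fst p = U.map Prod.fst q)
    (h₂ : U.map Prod.snd p = U.map Prod.snd q) : p = q :=
  U.prod_bijective.1 (Prod.ext h₁ h₂)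

lemma pair_fst_snd (p : U.Hyper (α × β)) : U.pair (U.map Prod.fst p) (U.map Prod.snd p) = p :=
  prod_ext (by simp) (by simp)

lemma pair_inj {x x' : U.Hyper α} {y y' : U.Hyper β} :
    U.pair x y = U.pair x' y' ↔ x = x' ∧ y = y' := by
  refine ⟨fun h => ?_, fun ⟨h₁, h₂⟩ => h₁ ▸ h₂ ▸ rfl⟩
  exact ⟨by simpa using congrArg (U.map Prod.fst) h, by simpa using congrArg (U.map Prod.snd) h⟩

lemma pair_map {f : γ → α} {g : γ → β} {p : U.Hyper γ} :
    U.pair (U.map f p) (U.map g p) = U.map (fun t => (f t, g t)) p :=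
  prod_ext (by simp [map_map]) (by simp [map_map])

lemma map_congr_ult {f g : γ → α} {p : U.Hyper γ} :
    U.map f p = U.map g p ↔ ∀ᶠ t in U.ult p, f t = g t := by
  have key : U.map (fun t => (f t, g t)) p ∈ U.starSet ((fun a : α => (a, a)) '' univ) ↔
      ∀ᶠ t in U.ult p, f t = g t := by
    rw [map_mem_starSet]
    simp
  rw [← key, U.starSet_image, U.starSet_univ, ← pair_map]
  constructor
  · intro h
    exact ⟨U.map f p, trivial, prod_ext (by simp [map_map]) (by simp [map_map, ← h])⟩
  · rintro ⟨q, -, hq⟩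
    have h₁ := congrArg (U.map Prod.fst) hq
    have h₂ := congrArg (U.map Prod.snd) hq
    simp only [map_fst_pair, map_snd_pair, map_map] at h₁ h₂
    rw [← h₁, ← h₂]

lemma std_eq_map (a : α) (p : U.Hyper γ) : U.std a = U.map (fun _ => a) p := by
  have h : U.map (fun _ => a) p ∈ U.starSet ({a} : Set α) :=
    map_mem_starSet.2 (Eventually.of_forall fun _ => rfl)
  rw [U.starSet_singleton] at h
  exact h.symm

lemma map_mem_ext {p : U.Hyper γ} {f : γ → α} {F : γ → Set α} :
    U.map f p ∈ U.ext (U.map F p) ↔ ∀ᶠ t in U.ult p, f t ∈ F t := by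
  change U.pair (U.map f p) (U.map F p) ∈ U.starSet {p : α × Set α | p.1 ∈ p.2} ↔ _
  rw [pair_map, map_mem_starSet]
  rfl

lemma map_le_map {p : U.Hyper γ} {f g : γ → ℕ} :
    U.map f p ≤ U.map g p ↔ ∀ᶠ t in U.ult p, f t ≤ g t := by
  change U.pair _ _ ∈ _ ↔ _
  rw [pair_map, map_mem_starSet]
  rfl

lemma map_add_map {p : U.Hyper γ} {f g : γ → ℕ} :
    U.map f p + U.map g p = U.map (fun t => f t + g t) p := by
  change U.map _ (U.pair _ _) = _
  rw [pair_map, map_map]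

lemma map_mul_map {p : U.Hyper γ} {f g : γ → ℕ} :
    U.map f p * U.map g p = U.map (fun t => f t * g t) p := by
  change U.map _ (U.pair _ _) = _
  rw [pair_map, map_map]

lemma exists_pair_rep (x : U.Hyper α) (y : U.Hyper β) :
    ∃ p : U.Hyper (α × β), U.map Prod.fst p = x ∧ U.map Prod.snd p = y :=
  ⟨U.pair x y, by simp, by simp⟩

omit [StandardType α] in
-- A Skolem function: its value at `p` is the internal witness.
lemma exists_map_of_eventually {p : U.Hyper γ} {φ : γ → α → Prop}
    (h : ∀ᶠ t in U.ult p, ∃ a, φ t a) : ∃ f : γ → α, ∀ᶠ t in U.ult p, φ t (f t) :=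
  h.choice

lemma map_id' (p : U.Hyper γ) : U.map (fun t => t) p = p := U.map_id p

lemma ext_map_subset {p : U.Hyper γ} {F G : γ → Set α} :
    U.ext (U.map F p) ⊆ U.ext (U.map G p) ↔ ∀ᶠ t in U.ult p, F t ⊆ G t := by
  constructor
  · intro h
    by_contra hc
    rw [← Ultrafilter.eventually_not] at hc
    obtain ⟨f, hf⟩ := exists_map_of_eventually (φ := fun t a => a ∈ F t ∧ a ∉ G t)
      (hc.mono fun t ht => not_subset.1 ht)
    have h₁ := map_mem_ext.1 (h (map_mem_ext.2 (hf.mono fun t ht => ht.1)))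
    obtain ⟨t, h₁, h₂⟩ := (h₁.and hf).exists
    exact h₂.2 h₁
  · intro h x hx
    obtain ⟨q, rfl, rfl⟩ := exists_pair_rep p x
    rw [map_map, map_mem_ext] at hx ⊢
    rw [eventually_ult_map] at h
    filter_upwards [h, hx] with t h₁ h₂ using h₁ h₂

lemma isInternal_ext (a : U.Hyper (Set α)) : U.IsInternal (U.ext a) := ⟨a, rfl⟩

/-- The value at an internal argument of the internal function with an internal parameter. -/
noncomputable def app (h : γ → α → β) (g : U.Hyper γ) (x : U.Hyper α) : U.Hyper β :=
  U.map (fun p : γ × α => h p.1 p.2) (U.pair g x)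

lemma app_map {h : δ → α → β} {g : γ → δ} {f : γ → α} {p : U.Hyper γ} :
    app h (U.map g p) (U.map f p) = U.map (fun t => h (g t) (f t)) p := by
  rw [app, pair_map, map_map]

end Transfer

/-! ### The order on the hyperintegers. -/

section Order

noncomputable instance : LinearOrder (U.Hyper ℕ) where
  le_refl x := by
    rw [← map_id' x, map_le_map]
    exact Eventually.of_forall fun _ => le_rfl
  le_trans x y z h₁ h₂ := by
    obtain ⟨q, hq, rfl⟩ := exists_pair_rep (U.pair x y) z
    obtain rfl : U.map (fun t => t.1.1) q = x := by
      rw [← map_fst_pair x y, ← hq, map_map]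
    obtain rfl : U.map (fun t => t.1.2) q = y := by
      rw [← map_snd_pair (U.map (fun t => t.1.1) q) y, ← hq, map_map]
    rw [map_le_map] at *
    filter_upwards [h₁, h₂] with t using le_trans
  le_antisymm x y h₁ h₂ := by
    obtain ⟨p, rfl, rfl⟩ := exists_pair_rep x y
    rw [map_le_map] at h₁ h₂
    rw [map_congr_ult]
    filter_upwards [h₁, h₂] with t using le_antisymm
  le_total x y := by
    obtain ⟨p, rfl, rfl⟩ := exists_pair_rep x y
    rw [map_le_map, map_le_map, ← Ultrafilter.eventually_or]
    exact Eventually.of_forall fun t => le_total _ _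
  toDecidableLE := Classical.decRel _

variable {γ : Type} [StandardType γ]

lemma map_lt_map {p : U.Hyper γ} {f g : γ → ℕ} :
    U.map f p < U.map g p ↔ ∀ᶠ t in U.ult p, f t < g t := by
  simp_rw [← not_le, map_le_map, Ultrafilter.eventually_not]

lemma std_lt_std {m n : ℕ} : U.std m < U.std n ↔ m < n := by
  rw [std_eq_map m (U.std 0), std_eq_map n (U.std 0), map_lt_map]
  simp

lemma std_le_std {m n : ℕ} : U.std m ≤ U.std n ↔ m ≤ n := by
  simpa using (std_lt_std (U := U) (m := n) (n := m)).not

lemma lt_std_succ {x : U.Hyper ℕ} {n : ℕ} : x < U.std (n + 1) ↔ x ≤ U.std n := by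
  rw [std_eq_map (n + 1) x, std_eq_map n x, ← map_id' x, map_map, map_map, map_lt_map, map_le_map]
  simp

lemma std_zero_le (x : U.Hyper ℕ) : U.std 0 ≤ x := by
  rw [std_eq_map 0 x]
  conv_rhs => rw [← map_id' x]
  rw [map_le_map]
  simp

lemma le_std_iff {x : U.Hyper ℕ} {n : ℕ} : x ≤ U.std n ↔ ∃ m ≤ n, x = U.std m := by
  induction n with
  | zero =>
    refine ⟨fun h => ⟨0, le_rfl, le_antisymm h (std_zero_le x)⟩, ?_⟩
    rintro ⟨m, hm, rfl⟩
    exact std_le_std.2 hm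
  | succ n ih =>
    rw [le_iff_lt_or_eq, lt_std_succ, ih]
    constructor
    · rintro (⟨m, hm, rfl⟩ | rfl)
      · exact ⟨m, by omega, rfl⟩
      · exact ⟨_, le_rfl, rfl⟩
    · rintro ⟨m, hm, rfl⟩
      rcases Nat.lt_or_eq_of_le hm with h | rfl
      · exact Or.inl ⟨m, by omega, rfl⟩
      · exact Or.inr rfl

lemma isInfinitelyLarge_iff {c : U.Hyper ℕ} : U.IsInfinitelyLarge c ↔ ∀ n, U.std n < c := by
  refine ⟨fun h n => lt_of_not_ge fun hc => ?_, fun h n hn => (h n).ne' hn⟩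
  obtain ⟨m, -, rfl⟩ := le_std_iff.1 hc
  exact h m rfl

end Order

/-! ### Countable saturation. -/

section Saturation

variable {α β γ δ : Type} [StandardType α] [StandardType β] [StandardType γ] [StandardType δ]

lemma CountablySaturated.exists_mem_ext (hU : U.CountablySaturated) (b : ℕ → U.Hyper (Set δ))
    (h : ∀ n, ∃ d, ∀ k < n, d ∈ U.ext (b k)) : ∃ d, ∀ n, d ∈ U.ext (b n) := by
  obtain ⟨d, hd⟩ := hU δ (fun n => U.ext (b n)) (fun n => ⟨b n, rfl⟩) (fun s => by
    obtain ⟨d, hd⟩ := h (s.sup id + 1)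
    exact ⟨d, mem_iInter₂.2 fun n hn =>
      hd n (Nat.lt_succ_of_le (Finset.le_sup (f := id) hn))⟩)
  exact ⟨d, mem_iInter.1 hd⟩

lemma CountablySaturated.exists_mem_ext_of_antitone (hU : U.CountablySaturated)
    (b : ℕ → U.Hyper (Set δ)) (hb : Antitone fun n => U.ext (b n))
    (h : ∀ n, (U.ext (b n)).Nonempty) : ∃ d, ∀ n, d ∈ U.ext (b n) :=
  hU.exists_mem_ext b fun n => (h n).imp fun _ hd _ hk => hb hk.le hd

/-- A sequence of internal sets extends to an internal sequence. -/
lemma CountablySaturated.exists_section (hU : U.CountablySaturated) (a : ℕ → U.Hyper (Set α)) :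
    ∃ S : U.Hyper (Set (ℕ × α)), ∀ n, a n = U.map (fun S => {x | (n, x) ∈ S}) S := by
  obtain ⟨S, hS⟩ := hU.exists_mem_ext
    (fun n => U.map (fun A : Set α => {S : Set (ℕ × α) | {x | (n, x) ∈ S} = A}) (a n)) (by
      intro n
      induction n with
      | zero => exact ⟨U.map (fun _ => ∅) (a 0), by simp⟩
      | succ n ih =>
        obtain ⟨S, hS⟩ := ih
        obtain ⟨p, rfl, hp⟩ := exists_pair_rep S (a n)
        -- Overwriting the section at `n` meets the new condition and leaves the earlier sections
        -- alone.
        refine ⟨U.map (fun p => {y | if y.1 = n then y.2 ∈ p.2 else y ∈ p.1}) p, fun k hk => ?_⟩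
        rcases Nat.lt_or_eq_of_le (Nat.lt_succ_iff.1 hk) with hk | rfl
        · obtain ⟨q, rfl, hq⟩ := exists_pair_rep p (a k)
          have := hS k hk
          rw [← hq, map_map, map_map, map_mem_ext] at this ⊢
          filter_upwards [this] with t ht
          simpa [hk.ne] using ht
        · rw [← hp, map_map, map_mem_ext]
          exact Eventually.of_forall fun t => by simp)
  refine ⟨S, fun n => ?_⟩
  have := hS n
  obtain ⟨p, hp, rfl⟩ := exists_pair_rep (a n) S
  rw [← hp, map_map, map_mem_ext] at this
  rw [← hp, map_map, map_congr_ult]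
  filter_upwards [this] with t ht using ht.symm

/-- Countably many internal sets and hyperintegers are given by one internal parameter. -/
lemma CountablySaturated.exists_common_param (hU : U.CountablySaturated)
    (a : ℕ → U.Hyper (Set α)) (d : ℕ → U.Hyper ℕ) :
    ∃ (p : U.Hyper (Set (ℕ × α) × Set (ℕ × ℕ))) (F : ℕ → Set (ℕ × α) × Set (ℕ × ℕ) → Set α)
      (D : ℕ → Set (ℕ × α) × Set (ℕ × ℕ) → ℕ),
      a = (fun n => U.map (F n) p) ∧ d = fun n => U.map (D n) p := by
  obtain ⟨S, hS⟩ := hU.exists_section a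
  -- Hyperintegers are coded as singletons and decoded by `sInf`.
  obtain ⟨T, hT⟩ := hU.exists_section fun n => U.map (fun m : ℕ => ({m} : Set ℕ)) (d n)
  obtain ⟨p, rfl, rfl⟩ := exists_pair_rep S T
  refine ⟨p, fun n (t : Set (ℕ × α) × Set (ℕ × ℕ)) => {x | (n, x) ∈ t.1},
    fun n (t : Set (ℕ × α) × Set (ℕ × ℕ)) => sInf {x | (n, x) ∈ t.2}, ?_, ?_⟩
  · funext n
    rw [hS, map_map]
  · funext n
    have := congrArg (U.map sInf) (hT n)
    simp only [map_map, csInf_singleton, map_id'] at this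
    exact this

/-- Saturation in pointwise form: standard solutions of finitely many conditions at a time yield one
internal solution of all of them. -/
lemma CountablySaturated.exists_of_forall_lt (hU : U.CountablySaturated) (p : U.Hyper γ)
    (φ : ℕ → γ → δ → Prop) (h : ∀ n, ∀ᶠ t in U.ult p, ∃ d, ∀ k < n, φ k t d) :
    ∃ q : U.Hyper (γ × δ), U.map Prod.fst q = p ∧ ∀ n, ∀ᶠ t : γ × δ in U.ult q, φ n t.1 t.2 := by
  obtain ⟨d, hd⟩ := hU.exists_mem_ext (fun n => U.map (fun t => {d | φ n t d}) p) (by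
    intro n
    obtain ⟨f, hf⟩ := exists_map_of_eventually (h n)
    refine ⟨U.map f p, fun k hk => ?_⟩
    rw [map_mem_ext]
    filter_upwards [hf] with t ht using ht k hk)
  refine ⟨U.pair p d, map_fst_pair _ _, fun n => ?_⟩
  have := hd n
  obtain ⟨q, rfl, rfl⟩ := exists_pair_rep p d
  rw [map_map, map_mem_ext] at this
  rw [pair_fst_snd]
  exact this

end Saturation

/-! ### Closure properties of countably determined sets. -/

section CountablyDetermined

variable {α β γ δ : Type} [StandardType α] [StandardType β] [StandardType γ] [StandardType δ]

lemma ext_map_const_univ (p : U.Hyper γ) : U.ext (U.map (fun _ => (univ : Set α)) p) = univ := by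
  refine eq_univ_of_forall fun x => ?_
  obtain ⟨q, rfl, rfl⟩ := exists_pair_rep p x
  rw [map_map, map_mem_ext]
  simp

lemma isInternal_univ : U.IsInternal (univ : Set (U.Hyper α)) :=
  ⟨_, (ext_map_const_univ (U.std 0)).symm⟩

/-- A set is countably determined iff membership in it depends only on membership in the sets of
some sequence of internal sets. -/
lemma isCD_iff {X : Set (U.Hyper α)} : U.IsCD X ↔ ∃ a : ℕ → U.Hyper (Set α),
    ∀ x y, (∀ n, x ∈ U.ext (a n) ↔ y ∈ U.ext (a n)) → x ∈ X → y ∈ X := by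
  constructor
  · rintro ⟨A, B, hA, rfl⟩
    choose a ha using hA
    refine ⟨a, fun x y h hx => ?_⟩
    have h' : ∀ n, x ∈ A n ↔ y ∈ A n := fun n => by rw [ha]; exact h n
    simpa [h'] using hx
  · rintro ⟨a, ha⟩
    obtain ⟨e, he⟩ := isInternal_univ (U := U) (α := α)
    -- Placing `univ` at index 0 turns the relative complements of the definition into full
    -- complements.
    let A : ℕ → Set (U.Hyper α) := fun n => Nat.casesOn n univ fun n => U.ext (a n)
    refine ⟨A, {b | ∃ x ∈ X, b = {m | x ∈ A m}}, ?_, ?_⟩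
    · rintro (_ | n)
      · exact ⟨e, he⟩
      · exact ⟨a n, rfl⟩
    · have hu : ⋃ n, A n = univ := eq_univ_of_forall fun x => mem_iUnion.2 ⟨0, mem_univ x⟩
      rw [hu]
      ext y
      simp only [mem_iUnion, mem_inter_iff, mem_iInter, Set.mem_sdiff, mem_univ, true_and, mem_compl_iff,
        exists_prop]
      constructor
      · intro hy
        exact ⟨{m | y ∈ A m}, ⟨y, hy, rfl⟩, fun _ h => h, fun _ h => h⟩
      · rintro ⟨_, ⟨x, hx, rfl⟩, h₁, h₂⟩
        exact ha x y (fun n => ⟨fun h => h₁ (n + 1) h, fun h => by_contra fun hc =>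
          h₂ (n + 1) hc h⟩) hx

lemma isCD_of_countable {ι : Type*} [Countable ι] (a : ι → U.Hyper (Set α)) {X : Set (U.Hyper α)}
    (h : ∀ x y, (∀ i, x ∈ U.ext (a i) ↔ y ∈ U.ext (a i)) → x ∈ X → y ∈ X) : U.IsCD X := by
  rw [isCD_iff]
  rcases isEmpty_or_nonempty ι with hι | hι
  · exact ⟨fun _ => U.map (fun _ => univ) (U.std 0),
      fun x y _ => h x y fun i => hι.elim i⟩
  · obtain ⟨f, hf⟩ := exists_surjective_nat ι
    exact ⟨fun n => a (f n), fun x y hxy => h x y fun i => by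
      obtain ⟨n, rfl⟩ := hf i
      exact hxy n⟩

lemma IsInternal.isCD {X : Set (U.Hyper α)} (h : U.IsInternal X) : U.IsCD X := by
  obtain ⟨a, rfl⟩ := h
  exact isCD_iff.2 ⟨fun _ => a, fun x y h => (h 0).1⟩

lemma IsCD.compl {X : Set (U.Hyper α)} (h : U.IsCD X) : U.IsCD Xᶜ := by
  rw [isCD_iff] at *
  obtain ⟨a, ha⟩ := h
  exact ⟨a, fun x y h hx hy => hx (ha y x (fun n => (h n).symm) hy)⟩

lemma IsCD.iUnion {ι : Type*} [Countable ι] {X : ι → Set (U.Hyper α)} (h : ∀ i, U.IsCD (X i)) :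
    U.IsCD (⋃ i, X i) := by
  choose a ha using fun i => isCD_iff.1 (h i)
  refine isCD_of_countable (fun p : ι × ℕ => a p.1 p.2) fun x y hxy hx => ?_
  obtain ⟨i, hi⟩ := mem_iUnion.1 hx
  exact mem_iUnion.2 ⟨i, ha i x y (fun n => hxy (i, n)) hi⟩

lemma IsCD.iInter {ι : Type*} [Countable ι] {X : ι → Set (U.Hyper α)} (h : ∀ i, U.IsCD (X i)) :
    U.IsCD (⋂ i, X i) := by
  rw [← compl_compl (⋂ i, X i), compl_iInter]
  exact (IsCD.iUnion fun i => (h i).compl).compl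

lemma IsCD.inter {X Y : Set (U.Hyper α)} (hX : U.IsCD X) (hY : U.IsCD Y) : U.IsCD (X ∩ Y) := by
  rw [inter_eq_iInter]
  exact IsCD.iInter fun b => by cases b <;> assumption

lemma ext_preimage (f : α → β) (a : U.Hyper (Set β)) :
    U.ext (U.map (fun A => f ⁻¹' A) a) = U.map f ⁻¹' U.ext a := by
  ext x
  obtain ⟨p, rfl, rfl⟩ := exists_pair_rep a x
  rw [map_map, map_mem_ext, mem_preimage, map_map, map_mem_ext]
  rfl

lemma ext_image (f : α → β) (a : U.Hyper (Set α)) :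
    U.ext (U.map (fun A => f '' A) a) = U.map f '' U.ext a := by
  ext x
  obtain ⟨p, rfl, rfl⟩ := exists_pair_rep a x
  rw [map_map, map_mem_ext]
  constructor
  · intro h
    obtain ⟨g, hg⟩ := exists_map_of_eventually h
    refine ⟨U.map g p, map_mem_ext.2 (hg.mono fun t ht => ht.1), ?_⟩
    rw [map_map, map_congr_ult]
    exact hg.mono fun t ht => ht.2
  · rintro ⟨y, hy, hyx⟩
    obtain ⟨q, rfl, rfl⟩ := exists_pair_rep p y
    simp only [map_map] at hy hyx
    rw [map_mem_ext] at hy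
    rw [map_congr_ult] at hyx
    rw [eventually_ult_map]
    filter_upwards [hy, hyx] with t h₁ h₂ using ⟨_, h₁, h₂⟩

lemma IsCD.preimage {X : Set (U.Hyper β)} (h : U.IsCD X) (f : α → β) :
    U.IsCD (U.map f ⁻¹' X) := by
  rw [isCD_iff] at *
  obtain ⟨a, ha⟩ := h
  refine ⟨fun n => U.map (fun A => f ⁻¹' A) (a n), fun x y h hx => ?_⟩
  simp only [ext_preimage] at h
  exact ha _ _ h hx

/-- Countably determined sets are the results of Souslin-type operations. -/
lemma isCD_of_souslin (a : ℕ → U.Hyper (Set α)) (S : Set (ℕ → ℕ)) :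
    U.IsCD {x | ∃ σ ∈ S, ∀ n, x ∈ U.ext (a (σ n))} :=
  isCD_iff.2 ⟨a, fun _ _ h ⟨σ, hσ, hx⟩ => ⟨σ, hσ, fun n => (h _).1 (hx n)⟩⟩

/-- The cells fixing membership in the first n generators are internal and countably many in all.
Each point of `X` determines a decreasing sequence of cells, and points sharing that sequence are
not separated by the generators. Monotonicity is what later allows saturation along each sequence.
-/
lemma CountablySaturated.exists_souslin (hU : U.CountablySaturated) {X : Set (U.Hyper α)}
    (h : U.IsCD X) : ∃ (a : ℕ → U.Hyper (Set α)) (S : Set (ℕ → ℕ)),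
      (∀ σ ∈ S, Antitone fun n => U.ext (a (σ n))) ∧
      X = {x | ∃ σ ∈ S, ∀ n, x ∈ U.ext (a (σ n))} := by
  obtain ⟨a, ha⟩ := isCD_iff.1 h
  obtain ⟨T, hT⟩ := hU.exists_section a
  obtain ⟨e, he⟩ := exists_surjective_nat (ℕ × Finset ℕ)
  let C : ℕ × Finset ℕ → U.Hyper (Set α) := fun c =>
    U.map (fun T : Set (ℕ × α) => {x | ∀ k < c.1, (k, x) ∈ T ↔ k ∈ c.2}) T
  have hC : ∀ c x, x ∈ U.ext (C c) ↔ ∀ k < c.1, x ∈ U.ext (a k) ↔ k ∈ c.2 := by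
    intro c x
    simp only [hT, C]
    obtain ⟨q, rfl, rfl⟩ := exists_pair_rep T x
    simp only [map_map, map_mem_ext]
    refine (eventually_all_finite (finite_Iio c.1)
      (p := fun k (t : Set (ℕ × α) × α) => ((k, t.2) ∈ t.1 ↔ k ∈ c.2))).trans ?_
    refine forall₂_congr fun k _ => ?_
    by_cases hk : k ∈ c.2
    · simp only [hk, iff_true]
      rfl
    · simp only [hk, iff_false]
      exact Ultrafilter.eventually_not
  have hf : ∀ x n, ∃ i, ∀ y, y ∈ U.ext (C (e i)) ↔ ∀ k < n, y ∈ U.ext (a k) ↔ x ∈ U.ext (a k) := by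
    classical
    intro x n
    obtain ⟨i, hi⟩ := he (n, (Finset.range n).filter fun k => x ∈ U.ext (a k))
    refine ⟨i, fun y => ?_⟩
    rw [hi, hC]
    refine forall₂_congr fun k hk => ?_
    simp only [Finset.mem_filter, Finset.mem_range]
    simp only [show k < n from hk, true_and]
  choose σ hσ using hf
  refine ⟨fun i => C (e i), σ '' X, ?_, ?_⟩
  · rintro _ ⟨x, -, rfl⟩ m n hmn y hy
    exact (hσ x m y).2 fun k hk => (hσ x n y).1 hy k (hk.trans_le hmn)
  · ext y
    constructor
    · intro hy
      exact ⟨σ y, mem_image_of_mem _ hy, fun n => (hσ y n y).2 fun _ _ => Iff.rfl⟩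
    · rintro ⟨_, ⟨x, hx, rfl⟩, h⟩
      exact ha x y (fun n => ((hσ x (n + 1) y).1 (h _) n n.lt_succ_self).symm) hx

/-- By saturation, the image of a decreasing intersection of internal sets is the intersection of
their images. -/
lemma IsCD.image (hU : U.CountablySaturated) {X : Set (U.Hyper α)} (h : U.IsCD X) (f : α → β) :
    U.IsCD (U.map f '' X) := by
  obtain ⟨a, S, hS, rfl⟩ := hU.exists_souslin h
  convert isCD_of_souslin (fun n => U.map (fun A => f '' A) (a n)) S using 1
  ext y
  simp only [ext_image]
  constructor
  · rintro ⟨x, ⟨σ, hσ, hx⟩, rfl⟩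
    exact ⟨σ, hσ, fun n => mem_image_of_mem _ (hx n)⟩
  · rintro ⟨σ, hσ, hy⟩
    have key : ∀ A : U.Hyper (Set α), ∀ x, x ∈ U.ext (U.map (fun t : Set α × β =>
        {x | x ∈ t.1 ∧ f x = t.2}) (U.pair A y)) ↔ x ∈ U.ext A ∧ U.map f x = y := by
      intro A x
      obtain ⟨p, rfl, hp⟩ := exists_pair_rep A y
      obtain ⟨q, rfl, rfl⟩ := exists_pair_rep p x
      rw [← hp]
      simp only [map_map, pair_map, map_mem_ext, map_congr_ult]
      exact eventually_and
    obtain ⟨x, hx⟩ := hU.exists_mem_ext_of_antitone _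
      (fun m n hmn x hx => (key (a (σ m)) x).2
        (((key (a (σ n)) x).1 hx).imp_left fun h => hS σ hσ hmn h))
      (fun n => by
        obtain ⟨x, hx⟩ := hy n
        exact ⟨x, (key _ x).2 hx⟩)
    exact ⟨x, ⟨σ, hσ, fun n => ((key _ x).1 (hx n)).1⟩, ((key _ x).1 (hx 0)).2⟩

end CountablyDetermined

/-! ### The preorder of countably determined embeddings. -/

section Reducibility

variable {X Y Z : Set (U.Hyper ℕ)} {γ : Type} [StandardType γ]

lemma pair_mem_graphOn {f : U.Hyper ℕ → U.Hyper ℕ} {x y : U.Hyper ℕ} :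
    U.pair x y ∈ U.graphOn X f ↔ x ∈ X ∧ y = f x := by
  constructor
  · rintro ⟨x', hx, h⟩
    obtain ⟨rfl, rfl⟩ := pair_inj.1 h
    exact ⟨hx, rfl⟩
  · rintro ⟨hx, rfl⟩
    exact ⟨x, hx, rfl⟩

lemma CDLe.trans (hU : U.CountablySaturated) (h₁ : U.CDLe X Y) (h₂ : U.CDLe Y Z) :
    U.CDLe X Z := by
  obtain ⟨f, hf, hfi, hfg⟩ := h₁
  obtain ⟨g, hg, hgi, hgg⟩ := h₂
  refine ⟨g ∘ f, hg.comp hf, hgi.comp hfi hf, ?_⟩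
  -- The graph of the composite is the projection of the set of triples (x, f x, g (f x)).
  convert ((hfg.preimage (fun p : ℕ × ℕ × ℕ => (p.1, p.2.1))).inter
    (hgg.preimage (fun p : ℕ × ℕ × ℕ => p.2))).image hU (fun p : ℕ × ℕ × ℕ => (p.1, p.2.2)) using 1
  ext q
  constructor
  · rintro ⟨x, hx, rfl⟩
    obtain ⟨p, rfl, hp⟩ := exists_pair_rep x (U.pair (f x) (g (f x)))
    refine ⟨p, ⟨?_, ?_⟩, ?_⟩
    · refine ⟨_, hx, ?_⟩
      rw [← pair_map]
      congr 1
      rw [← map_map (g := Prod.fst), hp, map_fst_pair]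
    · exact ⟨f _, hf hx, hp⟩
    · rw [← pair_map]
      congr 1
      rw [← map_map (g := Prod.snd), hp, map_snd_pair]
      rfl
  · rintro ⟨p, ⟨⟨x, hx, h₁⟩, ⟨y, hy, h₂⟩⟩, rfl⟩
    rw [← pair_map, pair_inj] at h₁
    have h₃ := congrArg (U.map Prod.fst) h₂
    have h₄ := congrArg (U.map Prod.snd) h₂
    simp only [map_map, map_fst_pair, map_snd_pair] at h₃ h₄
    refine ⟨x, hx, ?_⟩
    rw [← pair_map, h₁.1, h₄, ← h₃, h₁.2]
    rfl

lemma CDLe.mono_right (h : U.CDLe X Y) (hYZ : Y ⊆ Z) : U.CDLe X Z := by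
  obtain ⟨f, hf, hfi, hfg⟩ := h
  exact ⟨f, hf.mono_right hYZ, hfi, hfg⟩

lemma CDLe.mono_left (h : U.CDLe Y Z) (hXY : X ⊆ Y) (hX : U.IsCD X) : U.CDLe X Z := by
  obtain ⟨f, hf, hfi, hfg⟩ := h
  refine ⟨f, hf.mono_left hXY, hfi.mono hXY, ?_⟩
  convert hfg.inter (hX.preimage (fun p : ℕ × ℕ => p.1)) using 1
  ext q
  rw [← pair_fst_snd q, mem_inter_iff, pair_mem_graphOn, pair_mem_graphOn]
  simp only [mem_preimage, pair_fst_snd]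
  exact ⟨fun h => ⟨⟨hXY h.1, h.2⟩, h.1⟩, fun h => ⟨h.2, h.1.2⟩⟩

lemma isCD_graphOn_app (hX : U.IsCD X) (h : γ → ℕ → ℕ) (g : U.Hyper γ) :
    U.IsCD (U.graphOn X (app h g)) := by
  convert (hX.preimage (fun p : ℕ × ℕ => p.1)).inter (IsInternal.isCD
    ⟨U.map (fun g => {p : ℕ × ℕ | p.2 = h g p.1}) g, rfl⟩) using 1
  ext q
  obtain ⟨p, rfl, rfl⟩ := exists_pair_rep g q
  rw [mem_inter_iff, map_map, map_mem_ext, mem_preimage, map_map,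
    show (U.map Prod.snd p) = U.pair (U.map (fun t => t.2.1) p) (U.map (fun t => t.2.2) p) by
      rw [pair_map],
    pair_mem_graphOn, app_map, map_congr_ult]
  rfl

/-- A map which is piecewise internal, on countably many countably determined pieces, has a
countably determined graph. -/
lemma isCD_graphOn_of_pieces {ι : Type*} [Countable ι] {P : ι → Set (U.Hyper ℕ)}
    (hP : ∀ i, U.IsCD (P i)) (hXP : X = ⋃ i, P i) (h : γ → ℕ → ℕ) (g : ι → U.Hyper γ)
    {f : U.Hyper ℕ → U.Hyper ℕ} (hf : ∀ i, ∀ x ∈ P i, f x = app h (g i) x) :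
    U.IsCD (U.graphOn X f) := by
  convert IsCD.iUnion fun i => isCD_graphOn_app (hP i) h (g i) using 1
  ext q
  rw [← pair_fst_snd q, mem_iUnion]
  simp only [pair_mem_graphOn]
  rw [hXP, mem_iUnion]
  constructor
  · rintro ⟨⟨i, hi⟩, h⟩
    exact ⟨i, hi, by rw [h, hf i _ hi]⟩
  · rintro ⟨i, hi, h⟩
    exact ⟨⟨i, hi⟩, by rw [h, hf i _ hi]⟩

lemma CDLe.of_subset (hX : U.IsCD X) (h : X ⊆ Y) : U.CDLe X Y := by
  have hid : app (fun _ x => x) (U.std 0) = fun x : U.Hyper ℕ => x := by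
    funext x
    exact map_snd_pair (U.std 0) x
  have := isCD_graphOn_app hX (fun _ x => x) (U.std 0)
  rw [hid] at this
  exact ⟨fun x => x, h, fun _ _ _ _ h => h, this⟩

lemma CDLe.infinite (h : U.CDLe X Y) (hX : X.Infinite) : Y.Infinite := by
  obtain ⟨f, hf, hfi, -⟩ := h
  exact (hX.image hfi).mono hf.image_subset

end Reducibility

end NonstandardUniverse

/-! ### Standard combinatorics of finite chains of sets. -/

lemma exists_injOn_of_lt_encard (W : ℕ → Set ℕ) :
    ∃ f : ℕ → ℕ, InjOn f {y | (y : ℕ∞) < (W y).encard} ∧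
      ∀ y : ℕ, (y : ℕ∞) < (W y).encard → f y ∈ W y := by
  classical
  -- Greedy choice: the `y` earlier values cannot exhaust a set with more than `y` elements.
  have key : ∀ (y : ℕ) (g : ∀ m < y, ℕ), (y : ℕ∞) < (W y).encard →
      ∃ z ∈ W y, ∀ m (hm : m < y), z ≠ g m hm := by
    intro y g hy
    by_contra! hc
    have hsub : W y ⊆ (fun m => if hm : m < y then g m hm else 0) '' Iio y := by
      intro z hz
      obtain ⟨m, hm, h⟩ := hc z hz
      exact ⟨m, hm, by simp [hm, h]⟩
    have := (encard_le_encard hsub).trans (encard_image_le _ _)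
    rw [← Finset.coe_Iio, encard_coe_eq_coe_finsetCard, Nat.card_Iio] at this
    exact absurd hy this.not_gt
  let f : ℕ → ℕ := fun n => Nat.strongRec (motive := fun _ => ℕ)
    (fun y g => if h : ∃ z ∈ W y, ∀ m (hm : m < y), z ≠ g m hm then h.choose else 0) n
  have hf : ∀ y : ℕ, (y : ℕ∞) < (W y).encard → f y ∈ W y ∧ ∀ m < y, f y ≠ f m := by
    intro y hy
    have h := key y (fun m _ => f m) hy
    have hfy : f y = h.choose := by
      simp only [f]
      rw [Nat.strongRec]
      exact dif_pos h
    rw [hfy]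
    exact h.choose_spec
  refine ⟨f, fun x hx y hy hxy => ?_, fun y hy => (hf y hy).1⟩
  rcases lt_trichotomy x y with h | h | h
  · exact absurd hxy.symm ((hf y hy).2 x h)
  · exact h
  · exact absurd hxy ((hf x hx).2 y h)

/-- Finitely many sets forming a chain are enumerated simultaneously by one function. -/
lemma exists_enumeration_of_chain (Z : ℕ → Set ℕ) (n : ℕ)
    (hZ : ∀ i < n, ∀ j < n, Z i ⊆ Z j ∨ Z j ⊆ Z i) :
    ∃ f : ℕ → ℕ, InjOn f {y | ∃ k < n, (y : ℕ∞) < (Z k).encard} ∧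
      ∀ k < n, ∀ y : ℕ, (y : ℕ∞) < (Z k).encard → f y ∈ Z k := by
  -- The intersection of the members having more than `y` elements; by the chain condition it
  -- contains the smallest of them, so it is itself large enough when one exists.
  let W : ℕ → Set ℕ := fun y => {x | ∀ k < n, (y : ℕ∞) < (Z k).encard → x ∈ Z k}
  have hW : ∀ y : ℕ, (∃ k < n, (y : ℕ∞) < (Z k).encard) → (y : ℕ∞) < (W y).encard := by
    rintro y ⟨k, hk⟩
    obtain ⟨m, hm⟩ := ((finite_Iio n).subset
      (fun k (hk : k < n ∧ (y : ℕ∞) < (Z k).encard) => hk.1)).exists_minimalFor Z _ ⟨k, hk⟩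
    refine hm.1.2.trans_le (encard_le_encard fun x hx j hj hj' => ?_)
    rcases hZ m hm.1.1 j hj with h | h
    · exact h hx
    · exact hm.2 ⟨hj, hj'⟩ h hx
  obtain ⟨f, hf, hfW⟩ := exists_injOn_of_lt_encard W
  exact ⟨f, hf.mono hW, fun k hk y hy => hfW y (hW y ⟨k, hk, hy⟩) k hk hy⟩

/-- The inverse of a simultaneous enumeration: by counting, the enumeration maps the first |Z k|
numbers onto the finite set `Z k`. -/
lemma exists_ranking_of_chain (Z : ℕ → Set ℕ) (n : ℕ)
    (hZ : ∀ i < n, ∀ j < n, Z i ⊆ Z j ∨ Z j ⊆ Z i) (d : ℕ → ℕ)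
    (hd : ∀ k < n, (Z k).encard ≤ d k) :
    ∃ g : ℕ → ℕ, ∀ k < n, InjOn g (Z k) ∧ ∀ x ∈ Z k, g x < d k := by
  obtain ⟨f, hf, hfZ⟩ := exists_enumeration_of_chain Z n hZ
  have hsurj : ∀ k < n, ∀ x ∈ Z k, ∃ y : ℕ, (y : ℕ∞) < (Z k).encard ∧ f y = x := by
    intro k hk x hx
    have hfin : (Z k).Finite := finite_of_encard_le_coe (hd k hk)
    have hlt : ∀ y : ℕ, (y : ℕ∞) < (Z k).encard ↔ y < (Z k).ncard := by
      intro y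
      rw [← hfin.cast_ncard_eq]
      exact Nat.cast_lt
    have himg : f '' Iio (Z k).ncard = Z k := by
      refine eq_of_subset_of_ncard_le ?_ ?_ hfin
      · rintro _ ⟨y, hy, rfl⟩
        exact hfZ k hk y ((hlt y).2 hy)
      · have hinj : InjOn f (Iio (Z k).ncard) := hf.mono fun y hy =>
          show ∃ k < n, (y : ℕ∞) < (Z k).encard from ⟨k, hk, (hlt y).2 hy⟩
        rw [hinj.ncard_image, ← Finset.coe_Iio, ncard_coe_finset, Nat.card_Iio]
    rw [← himg] at hx
    obtain ⟨y, hy, rfl⟩ := hx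
    exact ⟨y, (hlt y).2 hy, rfl⟩
  refine ⟨Function.invFunOn f {y | ∃ k < n, (y : ℕ∞) < (Z k).encard}, fun k hk => ⟨?_, ?_⟩⟩
  · intro x hx x' hx' h
    obtain ⟨y, hy, rfl⟩ := hsurj k hk x hx
    obtain ⟨y', hy', rfl⟩ := hsurj k hk x' hx'
    rw [hf.leftInvOn_invFunOn ⟨k, hk, hy⟩, hf.leftInvOn_invFunOn ⟨k, hk, hy'⟩] at h
    rw [h]
  · intro x hx
    obtain ⟨y, hy, rfl⟩ := hsurj k hk x hx
    rw [hf.leftInvOn_invFunOn ⟨k, hk, hy⟩]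
    exact_mod_cast hy.trans_le (hd k hk)

namespace NonstandardUniverse

open Filter

variable {U : NonstandardUniverse.{u}}

/-! ### Internal cardinality and simultaneous enumeration. -/

section Cardinality

variable {α β γ : Type} [StandardType α] [StandardType β] [StandardType γ]

variable (U) in
/-- The hyperinteger `c` is less than the internal cardinality of the internal set given by `a`. -/
def LtCard (c : U.Hyper ℕ) (a : U.Hyper (Set α)) : Prop :=
  U.pair c a ∈ U.starSet {p : ℕ × Set α | (p.1 : ℕ∞) < p.2.encard}

lemma ltCard_map {p : U.Hyper γ} {f : γ → ℕ} {F : γ → Set α} :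
    U.LtCard (U.map f p) (U.map F p) ↔ ∀ᶠ t in U.ult p, (f t : ℕ∞) < (F t).encard := by
  rw [LtCard, pair_map, map_mem_starSet]
  rfl

lemma not_ltCard_map {p : U.Hyper γ} {f : γ → ℕ} {F : γ → Set α} :
    ¬ U.LtCard (U.map f p) (U.map F p) ↔ ∀ᶠ t in U.ult p, (F t).encard ≤ f t := by
  rw [ltCard_map, ← Ultrafilter.eventually_not]
  simp only [not_lt]

lemma setOf_ltCard (a : U.Hyper (Set α)) :
    {c | U.LtCard c a} = U.ext (U.map (fun A => {n : ℕ | (n : ℕ∞) < A.encard}) a) := by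
  ext c
  obtain ⟨p, rfl, rfl⟩ := exists_pair_rep a c
  rw [map_map, map_mem_ext, mem_ofPred_eq, ltCard_map]
  rfl

lemma LtCard.mono {a b : U.Hyper (Set α)} {c d : U.Hyper ℕ} (h : U.LtCard c a) (hdc : d ≤ c)
    (hab : U.ext a ⊆ U.ext b) : U.LtCard d b := by
  obtain ⟨p, rfl, rfl⟩ := exists_pair_rep c d
  obtain ⟨q, rfl, rfl⟩ := exists_pair_rep a b
  obtain ⟨r, rfl, rfl⟩ := exists_pair_rep p q
  simp only [map_map] at *
  rw [ltCard_map] at *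
  rw [map_le_map] at hdc
  rw [ext_map_subset] at hab
  filter_upwards [h, hdc, hab] with t h₁ h₂ h₃
  exact (Nat.cast_le.2 h₂).trans_lt (h₁.trans_le (encard_le_encard h₃))

/-- Countably many internal sets forming a chain are enumerated simultaneously by one internal
function. -/
lemma CountablySaturated.exists_enumeration (hU : U.CountablySaturated) (Z : ℕ → U.Hyper (Set ℕ))
    (hZ : ∀ i j, U.ext (Z i) ⊆ U.ext (Z j) ∨ U.ext (Z j) ⊆ U.ext (Z i)) :
    ∃ S : U.Hyper (Set (ℕ × ℕ)), ∀ k,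
      InjOn (app (fun S n => sInf {m | (n, m) ∈ S}) S) {c | U.LtCard c (Z k)} ∧
      MapsTo (app (fun S n => sInf {m | (n, m) ∈ S}) S) {c | U.LtCard c (Z k)}
        (U.ext (Z k)) := by
  obtain ⟨p, F, D, hF, -⟩ := hU.exists_common_param Z fun _ => U.std 0
  subst hF
  simp only [ext_map_subset, ← Ultrafilter.eventually_or] at hZ
  obtain ⟨q, rfl, hq⟩ := hU.exists_of_forall_lt (δ := Set (ℕ × ℕ)) p (fun k t S =>
      InjOn (fun n => sInf {m | (n, m) ∈ S}) {y : ℕ | (y : ℕ∞) < (F k t).encard} ∧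
        ∀ y : ℕ, (y : ℕ∞) < (F k t).encard → sInf {m | (y, m) ∈ S} ∈ F k t) (by
    intro n
    have := (eventually_all_finite (finite_Iio n)).2 fun i _ =>
      (eventually_all_finite (finite_Iio n)).2 fun j _ => hZ i j
    filter_upwards [this] with t ht
    obtain ⟨f, hf, hfZ⟩ := exists_enumeration_of_chain (fun k => F k t) n ht
    -- A function is coded by its graph and read off as `sInf` of the section, here a singleton.
    refine ⟨{x | x.2 = f x.1}, fun k hk => ?_⟩
    simp only [mem_ofPred_eq, ofPred_eq_eq_singleton, csInf_singleton]
    exact ⟨hf.mono fun y hy =>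
      show ∃ k < n, (y : ℕ∞) < (F k t).encard from ⟨k, hk, hy⟩, hfZ k hk⟩)
  refine ⟨U.map Prod.snd q, fun k => ⟨fun x hx y hy hxy => ?_, fun x hx => ?_⟩⟩
  · obtain ⟨r, rfl, rfl⟩ := exists_pair_rep x y
    obtain ⟨s, rfl, rfl⟩ := exists_pair_rep q r
    simp only [mem_ofPred_eq, map_map, ltCard_map, app_map, map_congr_ult] at hx hy hxy ⊢
    have := hq k
    rw [eventually_ult_map] at this
    filter_upwards [hx, hy, hxy, this] with t h₁ h₂ h₃ h₄ using h₄.1 h₁ h₂ h₃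
  · obtain ⟨s, rfl, rfl⟩ := exists_pair_rep q x
    simp only [mem_ofPred_eq, map_map, ltCard_map, app_map, map_mem_ext] at hx ⊢
    have := hq k
    rw [eventually_ult_map] at this
    filter_upwards [hx, this] with t h₁ h₂ using h₂.2 _ h₁

lemma CountablySaturated.exists_ranking (hU : U.CountablySaturated) (Z : ℕ → U.Hyper (Set ℕ))
    (hZ : ∀ i j, U.ext (Z i) ⊆ U.ext (Z j) ∨ U.ext (Z j) ⊆ U.ext (Z i))
    (d : ℕ → U.Hyper ℕ) (hd : ∀ k, ¬ U.LtCard (d k) (Z k)) :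
    ∃ S : U.Hyper (Set (ℕ × ℕ)), ∀ k,
      InjOn (app (fun S n => sInf {m | (n, m) ∈ S}) S) (U.ext (Z k)) ∧
      ∀ x ∈ U.ext (Z k), app (fun S n => sInf {m | (n, m) ∈ S}) S x < d k := by
  obtain ⟨p, F, D, hF, hD⟩ := hU.exists_common_param Z d
  subst hF hD
  simp only [ext_map_subset, ← Ultrafilter.eventually_or, not_ltCard_map] at hZ hd
  obtain ⟨q, rfl, hq⟩ := hU.exists_of_forall_lt (δ := Set (ℕ × ℕ)) p (fun k t S =>
      InjOn (fun n => sInf {m | (n, m) ∈ S}) (F k t) ∧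
        ∀ y ∈ F k t, sInf {m | (y, m) ∈ S} < D k t) (by
    intro n
    have := (eventually_all_finite (finite_Iio n)).2 fun i _ =>
      (eventually_all_finite (finite_Iio n)).2 fun j _ => hZ i j
    have h' := (eventually_all_finite (finite_Iio n)).2 fun i _ => hd i
    filter_upwards [this, h'] with t ht ht'
    obtain ⟨f, hf⟩ := exists_ranking_of_chain (fun k => F k t) n ht (fun k => D k t) ht'
    refine ⟨{x | x.2 = f x.1}, fun k hk => ?_⟩
    simp only [mem_ofPred_eq, ofPred_eq_eq_singleton, csInf_singleton]
    exact hf k hk)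
  refine ⟨U.map Prod.snd q, fun k => ⟨fun x hx y hy hxy => ?_, fun x hx => ?_⟩⟩
  · obtain ⟨r, rfl, rfl⟩ := exists_pair_rep x y
    obtain ⟨s, rfl, rfl⟩ := exists_pair_rep q r
    simp only [map_map, map_mem_ext, app_map, map_congr_ult] at hx hy hxy ⊢
    have := hq k
    rw [eventually_ult_map] at this
    filter_upwards [hx, hy, hxy, this] with t h₁ h₂ h₃ h₄ using h₄.1 h₁ h₂ h₃
  · obtain ⟨s, rfl, rfl⟩ := exists_pair_rep q x
    simp only [map_map, map_lt_map, app_map, map_mem_ext] at hx ⊢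
    have := hq k
    rw [eventually_ult_map] at this
    filter_upwards [hx, this] with t h₁ h₂ using h₂.2 _ h₁

end Cardinality

/-! ### Embeddings built from enumerations and rankings. -/

section Packing

variable {X Y : Set (U.Hyper ℕ)}

lemma CountablySaturated.cdLe_iInter_ext (hU : U.CountablySaturated) (Z : ℕ → U.Hyper (Set ℕ))
    (hZ : Antitone fun n => U.ext (Z n)) :
    U.CDLe {c | ∀ k, U.LtCard c (Z k)} (⋂ k, U.ext (Z k)) := by
  obtain ⟨S, hS⟩ := hU.exists_enumeration Z fun i j => (le_total i j).symm.imp (hZ ·) (hZ ·)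
  refine ⟨_, fun c hc => mem_iInter.2 fun k => (hS k).2 (hc k),
    (hS 0).1.mono fun c hc => hc 0, isCD_graphOn_app ?_ _ _⟩
  rw [ofPred_forall]
  exact IsCD.iInter fun k => IsInternal.isCD ⟨_, setOf_ltCard _⟩

lemma CountablySaturated.cdLe_iUnion_ext (hU : U.CountablySaturated) (Z : ℕ → U.Hyper (Set ℕ))
    (hZ : Monotone fun n => U.ext (Z n)) :
    U.CDLe {c | ∃ k, U.LtCard c (Z k)} (⋃ k, U.ext (Z k)) := by
  obtain ⟨S, hS⟩ := hU.exists_enumeration Z fun i j => (le_total i j).imp (hZ ·) (hZ ·)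
  refine ⟨_, fun c ⟨k, hk⟩ => mem_iUnion.2 ⟨k, (hS k).2 hk⟩, ?_, isCD_graphOn_app ?_ _ _⟩
  · rintro x ⟨i, hi⟩ y ⟨j, hj⟩ hxy
    exact (hS (max i j)).1 (hi.mono le_rfl (hZ (le_max_left i j)))
      (hj.mono le_rfl (hZ (le_max_right i j))) hxy
  · rw [ofPred_exists]
    exact IsCD.iUnion fun k => IsInternal.isCD ⟨_, setOf_ltCard _⟩

lemma CountablySaturated.cdLe_of_subset_iInter (hU : U.CountablySaturated) (hX : U.IsCD X)
    (G : ℕ → U.Hyper (Set ℕ)) (hG : Antitone fun n => U.ext (G n)) (hXG : ∀ k, X ⊆ U.ext (G k))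
    (d : ℕ → U.Hyper ℕ) (hd : ∀ k, ¬ U.LtCard (d k) (G k)) : U.CDLe X {c | ∀ k, c < d k} := by
  obtain ⟨S, hS⟩ := hU.exists_ranking G (fun i j => (le_total i j).symm.imp (hG ·) (hG ·)) d hd
  exact ⟨_, fun x hx k => (hS k).2 x (hXG k hx), (hS 0).1.mono (hXG 0), isCD_graphOn_app hX _ _⟩

lemma rank_bounds {S : Set ℕ} {d x : ℕ} (hS : S.encard ≤ d) (hx : x ∈ S) :
    (S ∩ Iio x).ncard < d := by
  have hfin : S.Finite := finite_of_encard_le_coe hS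
  have h : (S ∩ Iio x).ncard < S.ncard :=
    ncard_lt_ncard ⟨inter_subset_left, fun h => lt_irrefl x (h hx).2⟩ hfin
  rw [← hfin.cast_ncard_eq] at hS
  exact h.trans_le (by exact_mod_cast hS)

lemma rank_injOn (S : Set ℕ) : InjOn (fun x => (S ∩ Iio x).ncard) S := by
  have key : ∀ x ∈ S, ∀ y, x < y → (S ∩ Iio x).ncard < (S ∩ Iio y).ncard := fun x hx y hxy =>
    ncard_lt_ncard ⟨inter_subset_inter_right _ (Iio_subset_Iio hxy.le),
      fun h => lt_irrefl x (h ⟨hx, hxy⟩).2⟩ ((finite_Iio y).subset inter_subset_right)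
  intro x hx y hy hxy
  rcases lt_trichotomy x y with h | h | h
  · exact absurd hxy (key x hx y h).ne
  · exact h
  · exact absurd hxy.symm (key y hy x h).ne

/-- A countably determined set covered by countably many internal sets is mapped into the union of
consecutive segments whose lengths bound the cardinalities of these sets. -/
lemma cdLe_of_subset_iUnion (hX : U.IsCD X) (b : ℕ → U.Hyper (Set ℕ)) (hXb : X ⊆ ⋃ k, U.ext (b k))
    (d D : ℕ → U.Hyper ℕ) (hd : ∀ k, ¬ U.LtCard (d k) (b k)) (hD : ∀ k, D k + d k ≤ D (k + 1)) :
    U.CDLe X {x | ∃ k, x < D k} := by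
  classical
  -- A point of `b k` goes to `D k` plus its rank in `b k`, hence into [D k, D (k + 1)).
  let h : Set ℕ × ℕ → ℕ → ℕ := fun t x => t.2 + (t.1 ∩ Iio x).ncard
  have hbd : ∀ k, ∀ x ∈ U.ext (b k), D k ≤ app h (U.pair (b k) (D k)) x ∧
      app h (U.pair (b k) (D k)) x < D (k + 1) := by
    intro k x hx
    refine ⟨?_, lt_of_lt_of_le ?_ (hD k)⟩
    · obtain ⟨p, hp₁, hp₂⟩ := exists_pair_rep (b k) (D k)
      rw [← hp₁, ← hp₂, pair_fst_snd]
      obtain ⟨q, rfl, rfl⟩ := exists_pair_rep p x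
      rw [map_map, app_map, map_le_map]
      exact Eventually.of_forall fun t => Nat.le_add_right _ _
    · have hdk := hd k
      obtain ⟨p, hp₁, hp₂⟩ := exists_pair_rep (b k) (D k)
      obtain ⟨r, hr, rfl⟩ := exists_pair_rep (d k) x
      obtain ⟨q, rfl, rfl⟩ := exists_pair_rep p r
      rw [← hr, ← hp₁] at hdk
      rw [← hp₁] at hx
      rw [← hr, ← hp₁, ← hp₂]
      simp only [map_map, pair_map, map_add_map, map_mem_ext, not_ltCard_map] at hx hdk ⊢
      rw [app_map, map_lt_map]
      filter_upwards [hx, hdk] with t h₁ h₂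
      exact Nat.add_lt_add_left (rank_bounds h₂ h₁) _
  have hinj : ∀ k, InjOn (app h (U.pair (b k) (D k))) (U.ext (b k)) := by
    intro k x hx y hy hxy
    obtain ⟨p, hp₁, hp₂⟩ := exists_pair_rep (b k) (D k)
    obtain ⟨r, rfl, rfl⟩ := exists_pair_rep x y
    obtain ⟨q, rfl, rfl⟩ := exists_pair_rep p r
    rw [← hp₁, ← hp₂] at *
    simp only [map_map, pair_map, map_mem_ext] at *
    rw [app_map, app_map, map_congr_ult] at hxy
    rw [map_congr_ult]
    filter_upwards [hx, hy, hxy] with t h₁ h₂ h₃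
    exact rank_injOn _ h₁ h₂ (Nat.add_left_cancel h₃)
  have hmono : Monotone D := by
    refine monotone_nat_of_le_succ fun k => le_trans ?_ (hD k)
    obtain ⟨p, hp₁, hp₂⟩ := exists_pair_rep (D k) (d k)
    rw [← hp₁, ← hp₂, map_add_map, map_le_map]
    exact Eventually.of_forall fun t => Nat.le_add_right _ _
  have hex : ∀ x ∈ X, ∃ k, x ∈ U.ext (b k) := fun x hx => mem_iUnion.1 (hXb hx)
  -- Each point uses the first covering set containing it, so distinct pieces land in disjoint
  -- segments.
  let κ : U.Hyper ℕ → ℕ := fun x => sInf {k | x ∈ U.ext (b k)}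
  have hκ : ∀ x ∈ X, x ∈ U.ext (b (κ x)) := fun x hx => Nat.sInf_mem (hex x hx)
  refine ⟨fun x => app h (U.pair (b (κ x)) (D (κ x))) x,
    fun x hx => ⟨_, (hbd _ x (hκ x hx)).2⟩, fun x hx y hy hxy => ?_,
    isCD_graphOn_of_pieces (P := fun k => X ∩ (U.ext (b k) ∩ ⋂ j : Iio k, (U.ext (b j))ᶜ))
      (fun k => hX.inter ((isInternal_ext _).isCD.inter
        (IsCD.iInter fun j => (isInternal_ext _).isCD.compl))) ?_ h
      (fun k => U.pair (b k) (D k)) ?_⟩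
  · have hlt : ∀ x ∈ X, ∀ y ∈ X, κ x < κ y → app h (U.pair (b (κ x)) (D (κ x))) x <
        app h (U.pair (b (κ y)) (D (κ y))) y := fun x hx y hy hk =>
      (hbd _ x (hκ x hx)).2.trans_le ((hmono hk).trans (hbd _ y (hκ y hy)).1)
    rcases lt_trichotomy (κ x) (κ y) with hk | hk | hk
    · exact absurd hxy (hlt x hx y hy hk).ne
    · have hy' := hκ y hy
      simp only [← hk] at hxy hy'
      exact hinj _ (hκ x hx) hy' hxy
    · exact absurd hxy.symm (hlt y hy x hx hk).ne
  · ext x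
    simp only [mem_iUnion, mem_inter_iff, mem_iInter, mem_compl_iff, Subtype.forall, mem_Iio]
    exact ⟨fun hx => ⟨κ x, hx, hκ x hx, fun j hj => Nat.notMem_of_lt_sInf hj⟩,
      fun ⟨_, hx, _⟩ => hx⟩
  · rintro k x ⟨hx, hxk, hj⟩
    have : κ x = k := by
      refine le_antisymm (Nat.sInf_le hxk) (not_lt.1 fun hlt => ?_)
      exact mem_iInter.1 hj ⟨κ x, hlt⟩ (hκ x hx)
    simp only [this]

end Packing

end NonstandardUniverse

/-! ### A segment [0, d) does not embed in d/ℕ. -/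

lemma sum_div_two_pow_le (D n : ℕ) :
    ∑ k ∈ Finset.range n, D / 2 ^ (k + 2) + D / 2 ^ (n + 1) ≤ D / 2 := by
  induction n with
  | zero => simp
  | succ n ih =>
    have : D / 2 ^ (n + 1 + 1) = D / 2 ^ (n + 1) / 2 := by
      rw [pow_succ 2 (n + 1), Nat.div_div_eq_div_mul]
    rw [Finset.sum_range_succ, show n + 2 = n + 1 + 1 from rfl]
    omega

/-- Injective partial maps do not cover a segment by the preimages of small segments. -/
lemma exists_forall_not_two_pow_mul_le (F : ℕ → Set (ℕ × ℕ)) (n D : ℕ)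
    (hF : ∀ k < n, InjOn Prod.snd (F k)) (hD : 2 * n < D) :
    ∃ x < D, ∀ k < n, ∀ y, (x, y) ∈ F k → ¬ 2 ^ (k + 2) * y ≤ D := by
  classical
  by_contra! hc
  -- The points that `F k` relates to a value at most D / 2^(k+2). By injectivity their number is at
  -- most D / 2^(k+2) + 1, so n such sets cover at most D/2 + n < D points.
  let Q : ℕ → Finset ℕ := fun k =>
    (Finset.range D).filter fun x => ∃ y, (x, y) ∈ F k ∧ 2 ^ (k + 2) * y ≤ D
  have hQ : ∀ k < n, (Q k).card ≤ D / 2 ^ (k + 2) + 1 := by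
    intro k hk
    have hex : ∀ x ∈ Q k, ∃ y, (x, y) ∈ F k ∧ 2 ^ (k + 2) * y ≤ D := fun x hx =>
      (Finset.mem_filter.1 hx).2
    choose! g hg using hex
    rw [← Finset.card_range (D / 2 ^ (k + 2) + 1)]
    refine Finset.card_le_card_of_injOn g (fun x hx => ?_) fun x hx x' hx' h => ?_
    · rw [Finset.mem_coe, Finset.mem_range, Nat.lt_succ_iff, Nat.le_div_iff_mul_le (by positivity),
        mul_comm]
      exact (hg x hx).2
    · exact congrArg Prod.fst (hF k hk (hg x hx).1 (hg x' hx').1 h)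
  have hcov : Finset.range D ⊆ (Finset.range n).biUnion Q := by
    intro x hx
    obtain ⟨k, hk, y, hy⟩ := hc x (Finset.mem_range.1 hx)
    exact Finset.mem_biUnion.2 ⟨k, Finset.mem_range.2 hk, Finset.mem_filter.2 ⟨hx, y, hy⟩⟩
  have h₁ := (Finset.card_le_card hcov).trans (Finset.card_biUnion_le.trans
    (Finset.sum_le_sum fun k hk => hQ k (Finset.mem_range.1 hk)))
  rw [Finset.sum_add_distrib, Finset.card_range, Finset.sum_const, Finset.card_range,
    smul_eq_mul, mul_one] at h₁
  have h₂ := (Nat.le_add_right _ _).trans (sum_div_two_pow_le D n)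
  omega

namespace NonstandardUniverse

open Filter

variable {U : NonstandardUniverse.{u}}

section Measure

variable {α β γ : Type} [StandardType α] [StandardType β] [StandardType γ]

lemma ext_map_const_empty (p : U.Hyper γ) : U.ext (U.map (fun _ => (∅ : Set α)) p) = ∅ := by
  refine eq_empty_of_forall_notMem fun x hx => ?_
  obtain ⟨q, rfl, rfl⟩ := exists_pair_rep p x
  rw [map_map, map_mem_ext] at hx
  obtain ⟨t, ht⟩ := hx.exists
  exact ht

/-- Saturation makes some stage of every sequence for the graph injective in the second coordinate.
Countably many injective internal relations thus cover the graph, while counting and saturation give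
a point below `d` to which the k-th relates only values above d / 2^(k+2), never elements of d/ℕ. -/
lemma not_cdLe_divNat (hU : U.CountablySaturated) {d : U.Hyper ℕ} (hd : U.IsInfinitelyLarge d) :
    ¬ U.CDLe {x | x < d} (U.divNat d) := by
  classical
  rintro ⟨f, hf, hfi, hfg⟩
  obtain ⟨a, S, hS, hG⟩ := hU.exists_souslin hfg
  have hinj : ∀ σ ∈ S, ∃ n, ∀ᶠ A : Set (ℕ × ℕ) in U.ult (a (σ n)), InjOn Prod.snd A := by
    intro σ hσ
    by_contra! hc
    have key : ∀ (A : U.Hyper (Set (ℕ × ℕ))) (w : U.Hyper ((ℕ × ℕ) × (ℕ × ℕ))),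
        w ∈ U.ext (U.map (fun A : Set (ℕ × ℕ) => {w : (ℕ × ℕ) × (ℕ × ℕ) |
          w.1 ∈ A ∧ w.2 ∈ A ∧ w.1.2 = w.2.2 ∧ w.1 ≠ w.2}) A) ↔
        U.map Prod.fst w ∈ U.ext A ∧ U.map Prod.snd w ∈ U.ext A ∧
        U.map (fun w => w.1.2) w = U.map (fun w => w.2.2) w ∧
        U.map Prod.fst w ≠ U.map Prod.snd w := by
      intro A w
      obtain ⟨q, rfl, rfl⟩ := exists_pair_rep A w
      simp only [map_map, map_mem_ext, map_congr_ult, ne_eq, ← Ultrafilter.eventually_not,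
        ← eventually_and]
      rfl
    obtain ⟨w, hw⟩ := hU.exists_mem_ext_of_antitone _
      (fun m n hmn w hw => (key (a (σ m)) w).2 (by
        have := (key (a (σ n)) w).1 hw
        exact ⟨hS σ hσ hmn this.1, hS σ hσ hmn this.2.1, this.2.2⟩))
      (fun n => by
        have := hc n
        obtain ⟨g, hg⟩ := exists_map_of_eventually
          (φ := fun (A : Set (ℕ × ℕ)) (w : (ℕ × ℕ) × (ℕ × ℕ)) =>
            w.1 ∈ A ∧ w.2 ∈ A ∧ w.1.2 = w.2.2 ∧ w.1 ≠ w.2) (this.mono fun A hA => by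
              simp only [InjOn, not_forall] at hA
              obtain ⟨x, hx, y, hy, h, hne⟩ := hA
              exact ⟨(x, y), hx, hy, h, hne⟩)
        exact ⟨U.map g (a (σ n)), map_mem_ext.2 hg⟩)
    have hw' := fun n => (key (a (σ n)) w).1 (hw n)
    have h₁ : U.map Prod.fst w ∈ U.graphOn {x | x < d} f := by
      rw [hG]
      exact ⟨σ, hσ, fun n => (hw' n).1⟩
    have h₂ : U.map Prod.snd w ∈ U.graphOn {x | x < d} f := by
      rw [hG]
      exact ⟨σ, hσ, fun n => (hw' n).2.1⟩
    obtain ⟨x, hx, hx'⟩ := h₁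
    obtain ⟨y, hy, hy'⟩ := h₂
    obtain ⟨-, -, h₃, h₄⟩ := hw' 0
    rw [← map_map (g := Prod.snd) (f := Prod.fst), ← map_map (g := Prod.snd) (f := Prod.snd),
      hx', hy', map_snd_pair, map_snd_pair] at h₃
    exact h₄ (by rw [hx', hy', hfi hx hy h₃])
  let b : ℕ → U.Hyper (Set (ℕ × ℕ)) := fun i =>
    -- Non-injective relations are discarded; a useful stage of each sequence survives by `hinj`.
    U.map (fun A => if InjOn Prod.snd A then A else ∅) (a i)
  obtain ⟨p, F, E, hF, hE⟩ := hU.exists_common_param b fun _ => d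
  have hb : ∀ i, b i = U.map (F i) p := fun i => congrFun hF i
  have hE' : d = U.map (E 0) p := congrFun hE 0
  have hFinj : ∀ i, ∀ᶠ t in U.ult p, InjOn Prod.snd (F i t) := by
    intro i
    have : ∀ᶠ A : Set (ℕ × ℕ) in U.ult (b i), InjOn Prod.snd A := by
      rw [eventually_ult_map]
      refine Eventually.of_forall fun A => ?_
      split_ifs with h
      · exact h
      · exact injOn_empty _
    rwa [hb, eventually_ult_map] at this
  obtain ⟨q, hqp, hq⟩ := hU.exists_of_forall_lt (δ := ℕ) p (fun n t x => x < E 0 t ∧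
      ∀ y, (x, y) ∈ F n t → ¬ 2 ^ (n + 2) * y ≤ E 0 t) (by
    intro n
    have h₁ := (eventually_all_finite (finite_Iio n)).2 fun i _ => hFinj i
    have h₂ := isInfinitelyLarge_iff.1 hd (2 * n)
    rw [std_eq_map (2 * n) p, hE', map_lt_map] at h₂
    filter_upwards [h₁, h₂] with t h₁ h₂
    obtain ⟨x, hx, h⟩ := exists_forall_not_two_pow_mul_le (fun k => F k t) n (E 0 t) h₁ h₂
    exact ⟨x, fun k hk => ⟨hx, h k hk⟩⟩)
  subst hqp
  set x := U.map Prod.snd q with hx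
  have hxd : x < d := by
    rw [hE', map_map, map_lt_map]
    exact (hq 0).mono fun t ht => ht.1
  have hxG : U.pair x (f x) ∈ U.graphOn {x | x < d} f := ⟨x, hxd, rfl⟩
  rw [hG] at hxG
  obtain ⟨σ, hσ, hσx⟩ := hxG
  obtain ⟨n, hn⟩ := hinj σ hσ
  have hmem : U.pair x (f x) ∈ U.ext (b (σ n)) := by
    have hab : b (σ n) = a (σ n) := by
      conv_rhs => rw [← map_id' (a (σ n))]
      rw [map_congr_ult]
      filter_upwards [hn] with A hA using if_pos hA
    rw [hab]
    exact hσx n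
  have hsmall := hf hxd (2 ^ (σ n + 2)) (by positivity)
  obtain ⟨r, hr₁, hr₂⟩ := exists_pair_rep q (f x)
  rw [← hr₂, hx, hb, ← hr₁] at hmem
  rw [← hr₂, hE', ← hr₁, std_eq_map _ r] at hsmall
  simp only [map_map, map_mul_map, map_le_map, pair_map, map_mem_ext] at hmem hsmall
  have := hq (σ n)
  rw [← hr₁, eventually_ult_map] at this
  obtain ⟨t, ⟨h₁, h₂⟩, h₃⟩ := ((hmem.and hsmall).and this).exists
  exact h₃.2 _ h₁ h₂

end Measure

/-! ### Additive cuts and their rigidity. -/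

section Cuts

variable {X C C' : Set (U.Hyper ℕ)} {c d : U.Hyper ℕ}

lemma isInternal_setOf_lt (d : U.Hyper ℕ) : U.IsInternal {x | x < d} := by
  refine ⟨U.map (fun d => {x | x < d}) d, ?_⟩
  ext x
  obtain ⟨p, rfl, rfl⟩ := exists_pair_rep d x
  rw [map_map, map_mem_ext, mem_ofPred_eq, map_lt_map]
  rfl

lemma isInternal_setOf_le (d : U.Hyper ℕ) : U.IsInternal {x | x ≤ d} := by
  refine ⟨U.map (fun d => {x | x ≤ d}) d, ?_⟩
  ext x
  obtain ⟨p, rfl, rfl⟩ := exists_pair_rep d x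
  rw [map_map, map_mem_ext, mem_ofPred_eq, map_le_map]
  rfl

lemma isInternal_setOf_std_mul_le (n : ℕ) (d : U.Hyper ℕ) :
    U.IsInternal {x | U.std n * x ≤ d} := by
  refine ⟨U.map (fun d => {x | n * x ≤ d}) d, ?_⟩
  ext x
  obtain ⟨p, rfl, rfl⟩ := exists_pair_rep d x
  rw [map_map, map_mem_ext, mem_ofPred_eq, std_eq_map n p, map_mul_map, map_le_map]
  rfl

lemma std_succ_mul (n : ℕ) (x : U.Hyper ℕ) : U.std (n + 1) * x = U.std n * x + x := by
  rw [std_eq_map (n + 1) x, std_eq_map n x]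
  nth_rw 2 [← map_id' x]
  nth_rw 4 [← map_id' x]
  nth_rw 5 [← map_id' x]
  simp only [map_mul_map, map_add_map, Nat.succ_mul]

lemma std_zero_mul (x : U.Hyper ℕ) : U.std 0 * x = U.std 0 := by
  rw [std_eq_map 0 x]
  nth_rw 2 [← map_id' x]
  simp only [map_mul_map, zero_mul]

lemma IsAdditiveCut.std_mul_mem (hC : U.IsAdditiveCut C) {x : U.Hyper ℕ} (hx : x ∈ C) (n : ℕ) :
    U.std n * x ∈ C := by
  induction n with
  | zero =>
    rw [std_zero_mul]
    exact hC.1 x hx _ (std_zero_le x)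
  | succ n ih =>
    rw [std_succ_mul]
    exact hC.2 _ ih _ hx

lemma IsCut.lt_of_notMem (hC : U.IsCut C) (hd : d ∉ C) (hc : c ∈ C) : c < d :=
  lt_of_not_ge fun h => hd (hC c hc d h)

lemma IsAdditiveCut.subset_divNat (hC : U.IsAdditiveCut C) (hd : d ∉ C) : C ⊆ U.divNat d :=
  fun _ hx n _ => (hC.1.lt_of_notMem hd (hC.std_mul_mem hx n)).le

lemma IsAdditiveCut.std_mem (hC : U.IsAdditiveCut C) (hinf : C.Infinite) (n : ℕ) :
    U.std n ∈ C := by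
  by_contra h
  refine hinf ((finite_Iio n).image U.std |>.subset fun x hx => ?_)
  obtain ⟨m, -, rfl⟩ := le_std_iff.1 (hC.1.lt_of_notMem h hx).le
  exact mem_image_of_mem _ (std_lt_std.1 (hC.1.lt_of_notMem h hx))

/-- If `d` is in `C` but not in `C'`, then [0, d) ⊆ C would embed in C' ⊆ d/ℕ. -/
lemma IsAdditiveCut.subset_of_cdLe (hU : U.CountablySaturated) (hC : U.IsAdditiveCut C)
    (hC' : U.IsAdditiveCut C') (hinf : C'.Infinite) (h : U.CDLe C C') : C ⊆ C' := by
  intro d hd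
  by_contra hd'
  refine not_cdLe_divNat hU (d := d) (fun n hn => hd' (hn ▸ hC'.std_mem hinf n)) ?_
  exact (h.mono_left (fun x hx => hC.1 d hd x hx.le) (isInternal_setOf_lt d).isCD).mono_right
    (hC'.subset_divNat hd')

/-- Countable-determined equivalence of additive cuts is equality. -/
lemma IsAdditiveCut.eq_of_cdEquiv (hU : U.CountablySaturated) (hC : U.IsAdditiveCut C)
    (hC' : U.IsAdditiveCut C') (hX : X.Infinite) (h : U.CDEquiv C X) (h' : U.CDEquiv C' X) :
    C = C' :=
  (hC.subset_of_cdLe hU hC' (h'.2.infinite hX) (h.1.trans hU h'.2)).antisymm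
    (hC'.subset_of_cdLe hU hC (h.2.infinite hX) (h'.1.trans hU h.2))

end Cuts

end NonstandardUniverse

/-! ### Operations on internal sets, and covers by one internal set. -/

lemma encard_biUnion_Iio_le {α : Type*} (F : ℕ → Set α) (n d : ℕ)
    (h : ∀ k < n, (F k).encard ≤ d) : (⋃ k ∈ Iio n, F k).encard ≤ (n * d : ℕ) := by
  induction n with
  | zero => simp
  | succ n ih =>
    have : ⋃ k ∈ Iio (n + 1), F k = (⋃ k ∈ Iio n, F k) ∪ F n := by
      ext x
      simp only [mem_iUnion, mem_Iio, mem_union, Nat.lt_succ_iff_lt_or_eq, exists_prop]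
      constructor
      · rintro ⟨k, hk | rfl, hx⟩
        · exact Or.inl ⟨k, hk, hx⟩
        · exact Or.inr hx
      · rintro (⟨k, hk, hx⟩ | hx)
        · exact ⟨k, Or.inl hk, hx⟩
        · exact ⟨n, Or.inr rfl, hx⟩
    rw [this, Nat.succ_mul, Nat.cast_add]
    exact (encard_union_le _ _).trans (add_le_add (ih fun k hk => h k (hk.trans n.lt_succ_self))
      (h n n.lt_succ_self))

namespace NonstandardUniverse

open Filter

variable {U : NonstandardUniverse.{u}}

section InternalSets

variable {α γ : Type} [StandardType α] [StandardType γ]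

lemma ext_inter (a b : U.Hyper (Set α)) :
    U.ext (U.map (fun t : Set α × Set α => t.1 ∩ t.2) (U.pair a b)) = U.ext a ∩ U.ext b := by
  ext x
  obtain ⟨p, hp₁, hp₂⟩ := exists_pair_rep a b
  obtain ⟨q, rfl, rfl⟩ := exists_pair_rep p x
  rw [← hp₁, ← hp₂]
  simp only [pair_map, map_map, mem_inter_iff, map_mem_ext]
  exact eventually_and

lemma ext_union (a b : U.Hyper (Set α)) :
    U.ext (U.map (fun t : Set α × Set α => t.1 ∪ t.2) (U.pair a b)) = U.ext a ∪ U.ext b := by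
  ext x
  obtain ⟨p, hp₁, hp₂⟩ := exists_pair_rep a b
  obtain ⟨q, rfl, rfl⟩ := exists_pair_rep p x
  rw [← hp₁, ← hp₂]
  simp only [pair_map, map_map, mem_union, map_mem_ext]
  exact Ultrafilter.eventually_or

lemma exists_ext_eq_iInter (G : ℕ → U.Hyper (Set α)) :
    ∃ G' : ℕ → U.Hyper (Set α), ∀ k, U.ext (G' k) = ⋂ j ∈ Iic k, U.ext (G j) := by
  refine ⟨fun k => Nat.rec (G 0) (fun k g => U.map (fun t : Set α × Set α => t.1 ∩ t.2)
    (U.pair g (G (k + 1)))) k, fun k => ?_⟩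
  induction k with
  | zero => simp
  | succ k ih =>
    change U.ext (U.map _ (U.pair _ _)) = _
    rw [ext_inter, ih, ← Order.succ_eq_add_one, Order.Iic_succ, biInter_insert, inter_comm]

lemma exists_ext_eq_iUnion (G : ℕ → U.Hyper (Set α)) :
    ∃ G' : ℕ → U.Hyper (Set α), ∀ k, U.ext (G' k) = ⋃ j ∈ Iic k, U.ext (G j) := by
  refine ⟨fun k => Nat.rec (G 0) (fun k g => U.map (fun t : Set α × Set α => t.1 ∪ t.2)
    (U.pair g (G (k + 1)))) k, fun k => ?_⟩
  induction k with
  | zero => simp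
  | succ k ih =>
    change U.ext (U.map _ (U.pair _ _)) = _
    rw [ext_union, ih, ← Order.succ_eq_add_one, Order.Iic_succ, biUnion_insert, union_comm]

lemma exists_ext_eq_finset (s : Finset (U.Hyper α)) :
    ∃ a : U.Hyper (Set α), U.ext a = s ∧ ∀ᶠ A : Set α in U.ult a, A.encard = s.card := by
  classical
  induction s using Finset.induction_on with
  | empty =>
    refine ⟨U.map (fun _ => ∅) (U.std 0), by simpa using ext_map_const_empty _, ?_⟩
    rw [eventually_ult_map]
    simp
  | insert x s hx ih =>
    obtain ⟨a, ha, hcard⟩ := ih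
    refine ⟨U.map (fun t : α × Set α => insert t.1 t.2) (U.pair x a), ?_, ?_⟩
    · rw [Finset.coe_insert, ← ha]
      ext y
      obtain ⟨p, hp₁, hp₂⟩ := exists_pair_rep x a
      obtain ⟨q, rfl, rfl⟩ := exists_pair_rep p y
      rw [← hp₁, ← hp₂]
      simp only [pair_map, map_map, mem_insert_iff, map_mem_ext, map_congr_ult]
      exact Ultrafilter.eventually_or
    · have hxa : x ∉ U.ext a := by
        rw [ha]
        exact hx
      obtain ⟨p, rfl, rfl⟩ := exists_pair_rep x a
      rw [map_mem_ext, ← Ultrafilter.eventually_not] at hxa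
      rw [pair_fst_snd, eventually_ult_map]
      rw [eventually_ult_map] at hcard
      filter_upwards [hxa, hcard] with t h₁ h₂
      rw [encard_insert_of_notMem h₁, h₂, Finset.card_insert_of_notMem hx, Nat.cast_add,
        Nat.cast_one]

lemma not_ltCard_const_empty (c : U.Hyper ℕ) (p : U.Hyper γ) :
    ¬ U.LtCard c (U.map (fun _ => (∅ : Set α)) p) := by
  obtain ⟨q, rfl, rfl⟩ := exists_pair_rep c p
  rw [map_map, not_ltCard_map]
  simp

/-- An internal set has an internal cardinality unless it exceeds every hyperinteger. -/
lemma exists_card_or (a : U.Hyper (Set α)) :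
    (∃ w, ∀ c, c < w ↔ U.LtCard c a) ∨ ∀ c, U.LtCard c a := by
  rcases Ultrafilter.em (U.ult a) Set.Finite with h | h
  · refine Or.inl ⟨U.map ncard a, fun c => ?_⟩
    obtain ⟨q, rfl, rfl⟩ := exists_pair_rep a c
    rw [eventually_ult_map] at h
    rw [map_map, map_lt_map, ltCard_map]
    refine eventually_congr (h.mono fun t ht => ?_)
    rw [← ht.cast_ncard_eq]
    exact Nat.cast_lt.symm
  · refine Or.inr fun c => ?_
    obtain ⟨q, rfl, rfl⟩ := exists_pair_rep a c
    rw [eventually_ult_map] at h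
    rw [ltCard_map]
    filter_upwards [h] with t ht
    rw [Set.Infinite.encard_eq ht]
    exact ENat.natCast_lt_top _

/-- Countably many internal sets whose cardinalities are infinitely smaller than `d` are covered
by one internal set of cardinality at most `d`. -/
lemma CountablySaturated.exists_cover (hU : U.CountablySaturated) (b : ℕ → U.Hyper (Set α))
    {d d' : U.Hyper ℕ} (hd : d' ∈ U.divNat d) (hb : ∀ n, ¬ U.LtCard d' (b n)) :
    ∃ G, (∀ n, U.ext (b n) ⊆ U.ext G) ∧ ¬ U.LtCard d G := by
  obtain ⟨p, F, D, hF, hD⟩ := hU.exists_common_param b fun n => if n = 0 then d else d'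
  have h0 : d = U.map (D 0) p := congrFun hD 0
  have h1 : d' = U.map (D 1) p := congrFun hD 1
  subst hF h0 h1
  simp only [not_ltCard_map] at hb
  obtain ⟨q, rfl, hq⟩ := hU.exists_of_forall_lt (δ := Set α) p
    (fun n t G => F n t ⊆ G ∧ G.encard ≤ D 0 t) (by
    intro n
    have h₁ := (eventually_all_finite (finite_Iio n)).2 fun i _ => hb i
    rcases Nat.eq_zero_or_pos n with rfl | hn
    · exact Eventually.of_forall fun t => ⟨∅, by simp⟩
    -- A union of n sets of size at most d' has size at most n d' ≤ d.
    have h₂ := hd n hn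
    rw [std_eq_map n p, map_mul_map, map_le_map] at h₂
    filter_upwards [h₁, h₂] with t h₁ h₂
    refine ⟨⋃ k ∈ Iio n, F k t, fun k hk => ⟨subset_biUnion_of_mem (u := fun k => F k t) hk, ?_⟩⟩
    exact (encard_biUnion_Iio_le (fun k => F k t) n _ h₁).trans (Nat.cast_le.2 h₂))
  refine ⟨U.map Prod.snd q, fun n => ?_, ?_⟩
  · simp only [map_map]
    rw [ext_map_subset]
    exact (hq n).mono fun t ht => ht.1
  · rw [map_map, not_ltCard_map]
    exact (hq 0).mono fun t ht => ht.2

end InternalSets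

/-! ### The inner cut and comparisons with it. -/

section InnerCut

variable {X Y C : Set (U.Hyper ℕ)} {c d : U.Hyper ℕ}

variable (U) in
/-- The cut of hyperintegers less than the cardinality of some internal subset of `X`. -/
def innerCut (X : Set (U.Hyper ℕ)) : Set (U.Hyper ℕ) :=
  {c | ∃ a, U.ext a ⊆ X ∧ U.LtCard c a}

lemma isCut_innerCut (X : Set (U.Hyper ℕ)) : U.IsCut (U.innerCut X) :=
  fun _ ⟨a, ha, hc⟩ _ hyx => ⟨a, ha, hc.mono hyx le_rfl⟩

lemma std_mem_innerCut (hX : X.Infinite) (n : ℕ) : U.std n ∈ U.innerCut X := by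
  obtain ⟨s, hs, hcard⟩ := hX.exists_subset_card_eq (n + 1)
  obtain ⟨a, ha, hA⟩ := exists_ext_eq_finset s
  refine ⟨a, ha ▸ hs, ?_⟩
  rw [std_eq_map n a, ← map_id' a, map_map, ltCard_map]
  filter_upwards [hA] with A hA
  rw [hA, hcard]
  exact_mod_cast n.lt_succ_self

lemma isInfinitelyLarge_of_notMem_innerCut (hX : X.Infinite) (hc : c ∉ U.innerCut X) :
    U.IsInfinitelyLarge c := fun n hn => hc (hn ▸ std_mem_innerCut hX n)

/-- Saturation is applied one level up, to the internal families of sets Y ⊆ a n with more than `c`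
elements; `a n` itself witnesses the n-th. -/
lemma CountablySaturated.mem_innerCut (hU : U.CountablySaturated) (a : ℕ → U.Hyper (Set ℕ))
    (ha : Antitone fun n => U.ext (a n)) (haX : ⋂ n, U.ext (a n) ⊆ X)
    (hc : ∀ n, U.LtCard c (a n)) : c ∈ U.innerCut X := by
  have key : ∀ A Y : U.Hyper (Set ℕ), Y ∈ U.ext (U.map (fun t : Set ℕ × ℕ =>
      {Y : Set ℕ | Y ⊆ t.1 ∧ (t.2 : ℕ∞) < Y.encard}) (U.pair A c)) ↔
      U.ext Y ⊆ U.ext A ∧ U.LtCard c Y := by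
    intro A Y
    obtain ⟨p, hp₁, hp₂⟩ := exists_pair_rep A c
    obtain ⟨q, rfl, rfl⟩ := exists_pair_rep p Y
    rw [← hp₁, ← hp₂]
    simp only [pair_map, map_map, map_mem_ext, ext_map_subset, ltCard_map]
    exact eventually_and
  obtain ⟨Y, hY⟩ := hU.exists_mem_ext_of_antitone _
    (fun m n hmn Y hY => (key (a m) Y).2
      (((key (a n) Y).1 hY).imp_left fun h => h.trans (ha hmn)))
    (fun n => ⟨a n, (key (a n) (a n)).2 ⟨le_rfl, hc n⟩⟩)
  exact ⟨Y, (subset_iInter fun n => ((key _ Y).1 (hY n)).1).trans haX, ((key _ Y).1 (hY 0)).2⟩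

lemma CountablySaturated.cdLe_of_mem_innerCut (hU : U.CountablySaturated)
    (hc : c ∈ U.innerCut X) (hY : U.IsCD Y) (hYc : ∀ x ∈ Y, x ≤ c) : U.CDLe Y X := by
  obtain ⟨a, haX, hca⟩ := hc
  refine ((hU.cdLe_iInter_ext (fun _ => a) antitone_const).mono_right ?_).mono_left ?_ hY
  · exact (iInter_subset _ 0).trans haX
  · exact fun x hx _ => hca.mono (hYc x hx) le_rfl

/-- A sequence whose sets all had more than `c` elements would put `c` in the inner cut. So every
sequence has a small stage, and the large sets can be replaced by ∅. -/
lemma CountablySaturated.exists_subset_iUnion (hU : U.CountablySaturated) (hX : U.IsCD X)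
    (hc : c ∉ U.innerCut X) : ∃ b : ℕ → U.Hyper (Set ℕ),
      (∀ n, ¬ U.LtCard c (b n)) ∧ X ⊆ ⋃ n, U.ext (b n) := by
  classical
  obtain ⟨a, S, hS, rfl⟩ := hU.exists_souslin hX
  refine ⟨fun n => if U.LtCard c (a n) then U.map (fun _ => ∅) (a n) else a n, fun n => ?_,
    fun x ⟨σ, hσ, hx⟩ => ?_⟩
  · dsimp only
    split_ifs with h
    · exact not_ltCard_const_empty _ _
    · exact h
  · have : ∃ n, ¬ U.LtCard c (a (σ n)) := by
      by_contra! h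
      exact hc (hU.mem_innerCut (fun n => a (σ n)) (hS σ hσ)
        (fun x hx => ⟨σ, hσ, mem_iInter.1 hx⟩) h)
    obtain ⟨n, hn⟩ := this
    refine mem_iUnion.2 ⟨σ n, ?_⟩
    simp only [if_neg hn]
    exact hx n

lemma std_one_mul (x : U.Hyper ℕ) : U.std 1 * x = x := by
  rw [std_eq_map 1 x]
  nth_rw 2 [← map_id' x]
  rw [map_mul_map]
  simp only [one_mul, map_id']

lemma divNat_eq_iInter (c : U.Hyper ℕ) :
    U.divNat c = ⋂ n : ℕ, {x | U.std (n + 1) * x ≤ c} := by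
  ext x
  rw [mem_iInter]
  refine ⟨fun h n => h (n + 1) n.succ_pos, fun h n hn => ?_⟩
  obtain ⟨m, rfl⟩ := Nat.exists_eq_succ_of_ne_zero hn.ne'
  exact h m

lemma isCD_divNat (c : U.Hyper ℕ) : U.IsCD (U.divNat c) := by
  rw [divNat_eq_iInter]
  exact IsCD.iInter fun n => (isInternal_setOf_std_mul_le _ _).isCD

lemma IsInternal.isBorel {α : Type} [StandardType α] {X : Set (U.Hyper α)} (h : U.IsInternal X) :
    U.IsBorel X := MeasurableSpace.measurableSet_generateFrom h

lemma IsBorel.iUnion {α : Type} [StandardType α] {X : ℕ → Set (U.Hyper α)}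
    (h : ∀ n, U.IsBorel (X n)) : U.IsBorel (⋃ n, X n) :=
  @MeasurableSet.iUnion _ _ (MeasurableSpace.generateFrom _) _ _ h

lemma IsBorel.iInter {α : Type} [StandardType α] {X : ℕ → Set (U.Hyper α)}
    (h : ∀ n, U.IsBorel (X n)) : U.IsBorel (⋂ n, X n) :=
  @MeasurableSet.iInter _ _ (MeasurableSpace.generateFrom _) _ _ h

lemma isBorel_divNat (c : U.Hyper ℕ) : U.IsBorel (U.divNat c) := by
  rw [divNat_eq_iInter]
  exact IsBorel.iInter fun n => (isInternal_setOf_std_mul_le _ _).isBorel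

lemma isBorel_mulNat (c : U.Hyper ℕ) : U.IsBorel (U.mulNat c) := by
  have : U.mulNat c = ⋃ n : ℕ, {x | x ≤ c * U.std n} := by
    ext x
    rw [mem_iUnion]
    rfl
  rw [this]
  exact IsBorel.iUnion fun n => (isInternal_setOf_le _).isBorel

lemma isCut_divNat (c : U.Hyper ℕ) : U.IsCut (U.divNat c) := by
  intro x hx y hyx n hn
  refine le_trans ?_ (hx n hn)
  obtain ⟨p, rfl, rfl⟩ := exists_pair_rep x y
  rw [std_eq_map n p, map_mul_map, map_mul_map, map_le_map]
  rw [map_le_map] at hyx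
  filter_upwards [hyx] with t ht using Nat.mul_le_mul_left n ht

lemma isAdditiveCut_divNat (c : U.Hyper ℕ) : U.IsAdditiveCut (U.divNat c) := by
  refine ⟨isCut_divNat c, fun x hx y hy n hn => ?_⟩
  have hx' := hx (2 * n) (by omega)
  have hy' := hy (2 * n) (by omega)
  obtain ⟨p, rfl, rfl⟩ := exists_pair_rep x y
  obtain ⟨q, rfl, rfl⟩ := exists_pair_rep p c
  rw [std_eq_map n q]
  rw [std_eq_map (2 * n) q] at hx' hy'
  simp only [map_map, map_mul_map, map_add_map, map_le_map] at *
  filter_upwards [hx', hy'] with t h₁ h₂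
  nlinarith

lemma isAdditiveCut_mulNat (c : U.Hyper ℕ) : U.IsAdditiveCut (U.mulNat c) := by
  refine ⟨fun x ⟨n, hx⟩ y hyx => ⟨n, hyx.trans hx⟩, fun x ⟨m, hx⟩ y ⟨n, hy⟩ => ⟨m + n, ?_⟩⟩
  obtain ⟨p, rfl, rfl⟩ := exists_pair_rep x y
  obtain ⟨q, rfl, rfl⟩ := exists_pair_rep p c
  rw [std_eq_map m q] at hx
  rw [std_eq_map n q] at hy
  rw [std_eq_map (m + n) q]
  simp only [map_map, map_mul_map, map_add_map, map_le_map] at *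
  filter_upwards [hx, hy] with t h₁ h₂
  rw [mul_add]
  exact add_le_add h₁ h₂

lemma cdLe_mulNat (hX : U.IsCD X) (b : ℕ → U.Hyper (Set ℕ)) (hXb : X ⊆ ⋃ k, U.ext (b k))
    (hb : ∀ k, ¬ U.LtCard c (b k)) : U.CDLe X (U.mulNat c) := by
  refine (cdLe_of_subset_iUnion hX b hXb (fun _ => c) (fun k => c * U.std k) hb
    fun k => ?_).mono_right fun x ⟨k, hk⟩ => ⟨k, hk.le⟩
  rw [std_eq_map k c, std_eq_map (k + 1) c]
  nth_rw 1 [← map_id' c]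
  nth_rw 3 [← map_id' c]
  nth_rw 4 [← map_id' c]
  simp only [map_mul_map, map_add_map, map_le_map]
  exact Eventually.of_forall fun t => (Nat.mul_succ _ _).ge

lemma CountablySaturated.cdLe_mulNat (hU : U.CountablySaturated) (hX : U.IsCD X)
    (hc : c ∉ U.innerCut X) : U.CDLe X (U.mulNat c) := by
  obtain ⟨b, hb, hXb⟩ := hU.exists_subset_iUnion hX hc
  exact NonstandardUniverse.cdLe_mulNat hX b hXb hb

lemma CountablySaturated.existsUnique_cut (hU : U.CountablySaturated) (hX : X.Infinite)
    (hC : U.IsAdditiveCut C) (hB : U.IsBorel C) (h : U.CDEquiv C X) :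
    ∃! C : Set (U.Hyper ℕ), (U.IsAdditiveCut C ∧ U.IsBorel C) ∧ U.CDEquiv C X :=
  ⟨C, ⟨⟨hC, hB⟩, h⟩, fun _ h' => h'.1.1.eq_of_cdEquiv hU hC hX h'.2 h⟩

lemma CountablySaturated.dichotomy_of_between (hU : U.CountablySaturated) (hX : X.Infinite)
    (hc : U.IsInfinitelyLarge c) (h₁ : U.CDLe (U.divNat c) X) (h₂ : U.CDLe X (U.mulNat c)) :
    (∃! C : Set (U.Hyper ℕ), (U.IsAdditiveCut C ∧ U.IsBorel C) ∧ U.CDEquiv C X) ∨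
    (∃ c : U.Hyper ℕ, U.IsInfinitelyLarge c ∧
      U.CDLt (U.divNat c) X ∧ U.CDLt X (U.mulNat c)) := by
  by_cases h₃ : U.CDLe X (U.divNat c)
  · exact Or.inl (hU.existsUnique_cut hX (isAdditiveCut_divNat c) (isBorel_divNat c) ⟨h₁, h₃⟩)
  by_cases h₄ : U.CDLe (U.mulNat c) X
  · exact Or.inl (hU.existsUnique_cut hX (isAdditiveCut_mulNat c) (isBorel_mulNat c) ⟨h₄, h₂⟩)
  exact Or.inr ⟨c, hc, ⟨h₁, h₃⟩, ⟨h₂, h₄⟩⟩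

/-- The case in which the inner cut has a coinitial sequence of infinitely decreasing ratio. -/
lemma CountablySaturated.cdLe_innerCut_of_coinitial (hU : U.CountablySaturated) (hX : U.IsCD X)
    (a : ℕ → U.Hyper (Set ℕ)) (ha : U.innerCut X = {c | ∀ n, U.LtCard c (a n)})
    (hne : U.innerCut X ≠ univ)
    (hstep : ∀ d ∉ U.innerCut X, ∃ d' ∉ U.innerCut X, d' ∈ U.divNat d) :
    U.CDLe X (U.innerCut X) := by
  obtain ⟨e, he⟩ := (ne_univ_iff_exists_notMem _).1 hne
  have hnext : ∀ (n : ℕ) (d : {d // d ∉ U.innerCut X}), ∃ d' : {d // d ∉ U.innerCut X},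
      d'.1 ∈ U.divNat d.1 ∧ ∀ c < d'.1, U.LtCard c (a n) := by
    rintro n ⟨d, hd⟩
    obtain ⟨d', hd', hdd'⟩ := hstep d hd
    rcases exists_card_or (a n) with ⟨w, hw⟩ | h
    · rcases le_total d' w with h | h
      · exact ⟨⟨d', hd'⟩, hdd', fun c hc => (hw c).1 (hc.trans_le h)⟩
      -- When |a n| = w ≤ d', take w itself: it is outside the cut because it is not below |a n|.
      · refine ⟨⟨w, fun hwI => ?_⟩, isCut_divNat d d' hdd' w h, fun c hc => (hw c).1 hc⟩
        rw [ha] at hwI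
        exact lt_irrefl w ((hw w).2 (hwI n))
    · exact ⟨⟨d', hd'⟩, hdd', fun c _ => h c⟩
  choose nxt hnxt₁ hnxt₂ using hnext
  let D : ℕ → {d // d ∉ U.innerCut X} := fun n => Nat.rec ⟨e, he⟩ nxt n
  -- Sets of size at most `D (k + 1)`, infinitely smaller than `D k`, cover `X` and are merged into
  -- one set of size at most `D k`.
  have hG : ∀ k, ∃ G, X ⊆ U.ext G ∧ ¬ U.LtCard (D k).1 G := by
    intro k
    obtain ⟨b, hb, hXb⟩ := hU.exists_subset_iUnion hX (D (k + 1)).2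
    obtain ⟨G, hG, hGd⟩ := hU.exists_cover b (hnxt₁ k (D k)) hb
    exact ⟨G, hXb.trans (iUnion_subset hG), hGd⟩
  choose G hXG hGd using hG
  obtain ⟨G', hG'⟩ := exists_ext_eq_iInter G
  refine (hU.cdLe_of_subset_iInter hX G' (fun m n hmn => ?_) (fun k => ?_) (fun k => (D k).1)
    fun k h => hGd k (h.mono le_rfl ?_)).mono_right fun c hc => ?_
  · simp only [hG']
    exact biInter_subset_biInter_left (Iic_subset_Iic.2 hmn)
  · rw [hG']
    exact subset_iInter₂ fun j _ => hXG j
  · rw [hG']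
    exact biInter_subset_of_mem (mem_Iic.2 le_rfl)
  · rw [ha]
    exact fun n => hnxt₂ n (D n) c (hc (n + 1))

end InnerCut

end NonstandardUniverse

/-! ### The case analysis on the inner cut. -/

theorem mainTheorem5 (U : NonstandardUniverse.{u}) (hU : U.CountablySaturated)
    (X : Set (U.Hyper ℕ)) (hX : U.IsCD X) (hinf : X.Infinite) :
    (∃! C : Set (U.Hyper ℕ), (U.IsAdditiveCut C ∧ U.IsBorel C) ∧ U.CDEquiv C X) ∨
    (∃ c : U.Hyper ℕ, U.IsInfinitelyLarge c ∧
      U.CDLt (U.divNat c) X ∧ U.CDLt X (U.mulNat c)) := by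
  open NonstandardUniverse in
  have hcut := isCut_innerCut X
  by_cases hadd : ∀ x ∈ U.innerCut X, ∀ y ∈ U.innerCut X, x + y ∈ U.innerCut X
  swap
  · push Not at hadd
    obtain ⟨x, hx, y, hy, hxy⟩ := hadd
    have hc : max x y ∈ U.innerCut X := by
      rcases max_choice x y with h | h <;> rw [h] <;> assumption
    refine hU.dichotomy_of_between hinf (isInfinitelyLarge_of_notMem_innerCut hinf hxy)
      (hU.cdLe_of_mem_innerCut hc (isCD_divNat _) fun z hz => ?_) (hU.cdLe_mulNat hX hxy)
    -- An element of (x + y)/ℕ is at most half of x + y, hence at most max x y.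
    by_contra hlt
    rw [not_le, max_lt_iff] at hlt
    have hz' := hz 2 two_pos
    obtain ⟨p, rfl, rfl⟩ := exists_pair_rep x y
    obtain ⟨q, rfl, rfl⟩ := exists_pair_rep p z
    rw [std_eq_map 2 q] at hz'
    simp only [map_map, map_mul_map, map_add_map, map_le_map, map_lt_map] at hz' hlt
    obtain ⟨t, ⟨h₁, h₂⟩, h₃⟩ := ((hlt.1.and hlt.2).and hz').exists
    omega
  have haddcut : U.IsAdditiveCut (U.innerCut X) := ⟨hcut, hadd⟩
  obtain ⟨a, S, hS, hXS⟩ := hU.exists_souslin hX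
  by_cases h₂ : ∃ σ ∈ S, ∀ n, ∀ c ∈ U.innerCut X, U.LtCard c (a (σ n))
  · obtain ⟨σ, hσ, hσI⟩ := h₂
    have hσX : ⋂ n, U.ext (a (σ n)) ⊆ X := fun x hx => by
      rw [hXS]
      exact ⟨σ, hσ, mem_iInter.1 hx⟩
    have hI : U.innerCut X = {c | ∀ n, U.LtCard c (a (σ n))} :=
      Subset.antisymm (fun c hc n => hσI n c hc)
        fun c hc => hU.mem_innerCut _ (hS σ hσ) hσX hc
    have hle : U.CDLe (U.innerCut X) X := by
      rw [hI]
      exact (hU.cdLe_iInter_ext _ (hS σ hσ)).mono_right hσX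
    by_cases hdiv : ∃ c, c ∉ U.innerCut X ∧ U.divNat c ⊆ U.innerCut X
    · obtain ⟨c, hc, hcI⟩ := hdiv
      exact hU.dichotomy_of_between hinf (isInfinitelyLarge_of_notMem_innerCut hinf hc)
        (hle.mono_left hcI (isCD_divNat c)) (hU.cdLe_mulNat hX hc)
    push Not at hdiv
    refine Or.inl (hU.existsUnique_cut hinf haddcut ?_ ⟨hle, ?_⟩)
    · rw [hI, ofPred_forall]
      exact IsBorel.iInter fun n => IsInternal.isBorel ⟨_, setOf_ltCard _⟩
    · by_cases hne : U.innerCut X = univ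
      · rw [hne]
        exact CDLe.of_subset hX (subset_univ X)
      · exact hU.cdLe_innerCut_of_coinitial hX _ hI hne fun d hd =>
          let ⟨d', h, h'⟩ := not_subset.1 (hdiv d hd)
          ⟨d', h', h⟩
  · push Not at h₂
    -- Only the sets with size bounded in the cut are kept; every sequence contains one, so they
    -- still cover `X`.
    have hb : ∀ i, ∃ b : U.Hyper (Set ℕ), ∃ γ ∈ U.innerCut X, ¬ U.LtCard γ b ∧
        ((∃ c ∈ U.innerCut X, ¬ U.LtCard c (a i)) → b = a i) := by
      intro i
      by_cases h : ∃ c ∈ U.innerCut X, ¬ U.LtCard c (a i)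
      · obtain ⟨c, hc, hci⟩ := h
        exact ⟨a i, c, hc, hci, fun _ => rfl⟩
      · exact ⟨U.map (fun _ => ∅) (a i), U.std 0, std_mem_innerCut hinf 0,
          not_ltCard_const_empty _ _, fun h' => absurd h' h⟩
    choose b γ hγ hγb hba using hb
    have hXb : X ⊆ ⋃ i, U.ext (b i) := by
      intro x hx
      rw [hXS] at hx
      obtain ⟨σ, hσ, hx⟩ := hx
      obtain ⟨n, hn⟩ := h₂ σ hσ
      refine mem_iUnion.2 ⟨σ n, ?_⟩
      rw [hba _ hn]
      exact hx n
    -- Including `U.std i` makes a common bound infinitely large.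
    by_cases hcof : ∃ c ∈ U.innerCut X, ∀ i, γ i ≤ c ∧ U.std i ≤ c
    · obtain ⟨c, hc, hγc⟩ := hcof
      refine hU.dichotomy_of_between hinf (isInfinitelyLarge_iff.2 fun n =>
        (std_lt_std.2 n.lt_succ_self).trans_le (hγc (n + 1)).2)
        (hU.cdLe_of_mem_innerCut hc (isCD_divNat c) fun z hz => ?_)
        (NonstandardUniverse.cdLe_mulNat hX b hXb fun k h => hγb k (h.mono (hγc k).1 le_rfl))
      have := hz 1 one_pos
      rwa [std_one_mul] at this
    push Not at hcof
    have hE : ∀ i, max (γ i) (U.std i) ∈ U.innerCut X := fun i => by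
      rcases max_choice (γ i) (U.std i) with h | h <;> rw [h]
      exacts [hγ i, std_mem_innerCut hinf i]
    have hcofinal : ∀ c ∈ U.innerCut X, ∃ i, c ≤ max (γ i) (U.std i) := by
      intro c hc
      obtain ⟨i, hi⟩ := hcof c hc
      refine ⟨i, ?_⟩
      rcases le_or_gt (γ i) c with h | h
      · exact (hi h).le.trans (le_max_right _ _)
      · exact h.le.trans (le_max_left _ _)
    have hunion : U.innerCut X = ⋃ i, {x | x ≤ max (γ i) (U.std i)} :=
      Subset.antisymm (fun c hc => mem_iUnion.2 (hcofinal c hc))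
        (iUnion_subset fun i x hx => hcut _ (hE i) x hx)
    refine Or.inl (hU.existsUnique_cut hinf haddcut ?_ ⟨?_, ?_⟩)
    · rw [hunion]
      exact IsBorel.iUnion fun i => (isInternal_setOf_le _).isBorel
    · choose Y hYX hY using hE
      obtain ⟨Z, hZ⟩ := exists_ext_eq_iUnion Y
      have hZX : ⋃ k, U.ext (Z k) ⊆ X := iUnion_subset fun k => by
        rw [hZ]
        exact iUnion₂_subset fun j _ => hYX j
      have hI : U.innerCut X = {c | ∃ k, U.LtCard c (Z k)} := by
        refine Subset.antisymm (fun c hc => ?_)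
          fun c ⟨k, hk⟩ => ⟨Z k, (subset_iUnion _ k).trans hZX, hk⟩
        obtain ⟨i, hi⟩ := hcofinal c hc
        refine ⟨i, (hY i).mono hi ?_⟩
        rw [hZ]
        exact subset_biUnion_of_mem (u := fun j => U.ext (Y j)) (mem_Iic.2 le_rfl)
      rw [hI]
      refine (hU.cdLe_iUnion_ext Z fun m n hmn => ?_).mono_right hZX
      simp only [hZ]
      exact biUnion_subset_biUnion_left (Iic_subset_Iic.2 hmn)
    -- Partial sums of the bounds stay in the cut by additivity.
    · let D : ℕ → U.Hyper ℕ := fun k => Nat.rec (U.std 0) (fun k d => d + γ k) k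
      have hD : ∀ k, D k ∈ U.innerCut X := by
        intro k
        induction k with
        | zero => exact std_mem_innerCut hinf 0
        | succ k ih => exact hadd _ ih _ (hγ k)
      exact (cdLe_of_subset_iUnion hX b hXb γ D hγb fun k => le_rfl).mono_right
        fun x ⟨k, hk⟩ => hcut _ (hD k) x hk.le
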